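/- Let $n\ge 3$, let $\mathbf H^n$ be hyperbolic $n$-space, $G=\operatorname{Isom}(\mathbf H^n)$ its isometry group, $G^0=\operatorname{Isom}_+(\mathbf H^n)$ the subgroup of orientation-preserving isometries, and $B=\partial\mathbf H^n$ its boundary at infinity with the Lebesgue measure class. An ordered tuple $(b_0,\dots,b_n)\in B^{n+1}$ is called a regular ideal simplex if the ideal geodesic simplex with vertices $b_0,\dots,b_n$ is nondegenerate and each permutation of its vertices is realized by an element of $G$. Let $\Sigma^{\rm reg}_+\subset B^{n+1}$ be the set of positively oriented regular ideal simplices. The group $G^0$ acts simply transitively on it, and $\Sigma^{\rm reg}_+$ is equipped with the measure that corresponds to a Haar measure on $G^0$ under an orbit map $g\mapsto g\sigma$, $\sigma\in\Sigma^{\rm reg}_+$. (1) Let $\phi:B\to B$ be a Borel map such that $\phi^{n+1}=\phi\times\cdots\times\phi$ maps almost every point of $\Sigma^{\rm reg}_+$ into $\Sigma^{\rm reg}_+$. Then there exists a unique $g_0\in G^0$ with $\phi(b)=g_0b$ for almost every $b\in B$. (2) If $n>3$, then for every regular ideal simplex $\sigma$ the subgroup of $G$ generated by the reflections in the codimension-one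 faces of $\sigma$ (that is, in the hyperbolic hyperplanes spanned by these faces) is dense in $G$. -/

import Mathlib

open MeasureTheory
open scoped Matrix

noncomputable section

namespace Hyperbolic

/-- The Lorentzian form of signature `(n, 1)` on `ℝ^{n+1}`; coordinate `0` is time. -/
def form {n : ℕ} (x y : Fin (n + 1) → ℝ) : ℝ :=
  -(x 0 * y 0) + ∑ i : Fin n, x i.succ * y i.succ

/-- Hyperbolic `n`-space in the hyperboloid model: the upper sheet of `⟨x, x⟩ = -1`. -/
def Space (n : ℕ) : Set (Fin (n + 1) → ℝ) :=
  {x | form x x = -1 ∧ 0 < x 0}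

/-- The hyperbolic distance: `cosh d(x, y) = -⟨x, y⟩`. -/
def hdist {n : ℕ} (x y : Space n) : ℝ :=
  Real.arcosh (-form x.1 y.1)

theorem form_sub_left {n : ℕ} (x y z : Fin (n + 1) → ℝ) :
    form (x - y) z = form x z - form y z := by
  simp only [form, Pi.sub_apply, sub_mul, Finset.sum_sub_distrib]; ring

theorem form_neg_neg {n : ℕ} (x y : Fin (n + 1) → ℝ) : form (-x) (-y) = form x y := by
  simp [form]

theorem form_comm {n : ℕ} (x y : Fin (n + 1) → ℝ) : form x y = form y x := by
  simp [form, mul_comm]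

/-- The isometry group of hyperbolic `n`-space, as the group of invertible linear maps of
`ℝ^{n+1}` that preserve the Lorentzian form and the upper sheet. Restriction to the upper sheet
identifies it with the group of all isometries of hyperbolic space: see `hdist_isom` and
`existsUnique_isom` below. -/
def Isom (n : ℕ) : Subgroup (GL (Fin (n + 1)) ℝ) where
  carrier := {g | (∀ x y, form (g.1 *ᵥ x) (g.1 *ᵥ y) = form x y) ∧
    ∀ x ∈ Space n, g.1 *ᵥ x ∈ Space n}
  one_mem' := by simp
  mul_mem' := by
    rintro a b ⟨ha, ha'⟩ ⟨hb, hb'⟩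
    refine ⟨fun x y => ?_, fun x hx => ?_⟩
    · simp only [Units.val_mul, ← Matrix.mulVec_mulVec, ha, hb]
    · simp only [Units.val_mul, ← Matrix.mulVec_mulVec]
      exact ha' _ (hb' _ hx)
  inv_mem' := by
    rintro a ⟨ha, ha'⟩
    have key : ∀ x, a.1 *ᵥ ((a⁻¹).1 *ᵥ x) = x := fun x => by
      rw [Matrix.mulVec_mulVec, ← Units.val_mul]; simp
    have hf : ∀ x y, form ((a⁻¹).1 *ᵥ x) ((a⁻¹).1 *ᵥ y) = form x y := fun x y => by
      rw [← ha, key, key]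
    refine ⟨hf, fun x hx => ?_⟩
    have h1 : form ((a⁻¹).1 *ᵥ x) ((a⁻¹).1 *ᵥ x) = -1 := by rw [hf, hx.1]
    refine ⟨h1, ?_⟩
    by_contra hneg
    have h0 : ((a⁻¹).1 *ᵥ x) 0 ≠ 0 := by
      intro h0
      have : 0 ≤ form ((a⁻¹).1 *ᵥ x) ((a⁻¹).1 *ᵥ x) := by
        simp only [form, h0, mul_zero, neg_zero, zero_add]
        exact Finset.sum_nonneg fun i _ => mul_self_nonneg _
      linarith
    have hm : -((a⁻¹).1 *ᵥ x) ∈ Space n :=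
      ⟨by rw [form_neg_neg, h1], by
        simp only [Pi.neg_apply]
        have := lt_of_le_of_ne (not_lt.1 hneg) h0
        linarith⟩
    have h2 := (ha' _ hm).2
    rw [Matrix.mulVec_neg, key] at h2
    have h3 := hx.2
    simp only [Pi.neg_apply] at h2
    linarith

theorem isom_form {n : ℕ} (g : Isom n) (x y : Fin (n + 1) → ℝ) :
    form (g.1.1 *ᵥ x) (g.1.1 *ᵥ y) = form x y := g.2.1 x y

theorem form_self {n : ℕ} (x : Fin (n + 1) → ℝ) :
    form x x = -(x 0) ^ 2 + ∑ i : Fin n, x i.succ ^ 2 := by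
  simp only [form, sq]

theorem one_le_of_mem {n : ℕ} {x : Fin (n + 1) → ℝ} (hx : x ∈ Space n) : 1 ≤ x 0 := by
  have h1 := hx.1
  have h2 := hx.2
  rw [form_self] at h1
  have : 0 ≤ ∑ i : Fin n, x i.succ ^ 2 := Finset.sum_nonneg fun i _ => sq_nonneg _
  nlinarith

/-- Reversed Cauchy-Schwarz inequality: `-⟨x, y⟩` is in the range of `cosh`. -/
theorem one_le_neg_form {n : ℕ} {x y : Fin (n + 1) → ℝ} (hx : x ∈ Space n) (hy : y ∈ Space n) :
    1 ≤ -form x y := by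
  have hx1 := one_le_of_mem hx
  have hy1 := one_le_of_mem hy
  have h1 := hx.1
  have h2 := hy.1
  rw [form_self] at h1 h2
  have cs := Finset.sum_mul_sq_le_sq_mul_sq Finset.univ (fun i : Fin n => x i.succ)
    (fun i : Fin n => y i.succ)
  have e1 : ∑ i : Fin n, x i.succ ^ 2 = x 0 ^ 2 - 1 := by linarith
  have e2 : ∑ i : Fin n, y i.succ ^ 2 = y 0 ^ 2 - 1 := by linarith
  rw [e1, e2] at cs
  have h4 : 1 ≤ x 0 * y 0 := by nlinarith
  have : ∑ i : Fin n, x i.succ * y i.succ ≤ x 0 * y 0 - 1 := by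
    apply le_of_sq_le_sq _ (by linarith)
    nlinarith [sq_nonneg (x 0 - y 0)]
  simp only [form]
  linarith

/-- The base point `(1, 0)` of the hyperboloid. -/
def base (n : ℕ) : Fin (n + 1) → ℝ := Fin.cons 1 0

theorem base_mem (n : ℕ) : base n ∈ Space n := by
  simp [Space, form, base]

theorem form_base {n : ℕ} (x : Fin (n + 1) → ℝ) : form (base n) x = -x 0 := by
  simp [form, base]

/-- Isometries preserve the future light cone. -/
theorem isom_time_pos {n : ℕ} (g : Isom n) {v : Fin (n + 1) → ℝ} (hv : form v v = 0)
    (hv0 : 0 < v 0) : 0 < (g.1.1 *ᵥ v) 0 := by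
  have hy := (g⁻¹).2.2 _ (base_mem n)
  have hk : g.1.1 *ᵥ ((g⁻¹).1.1 *ᵥ base n) = base n := by
    rw [Matrix.mulVec_mulVec, ← Units.val_mul, ← Subgroup.coe_mul]; simp
  have hf := isom_form g ((g⁻¹).1.1 *ᵥ base n) v
  rw [hk, form_base] at hf
  generalize (g⁻¹).1.1 *ᵥ base n = y at hf hy
  have hy1 := one_le_of_mem hy
  have h1 := hy.1
  rw [form_self] at h1 hv
  have cs := Finset.sum_mul_sq_le_sq_mul_sq Finset.univ (fun i : Fin n => y i.succ)
    (fun i : Fin n => v i.succ)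
  have e1 : ∑ i : Fin n, y i.succ ^ 2 = y 0 ^ 2 - 1 := by linarith
  have e2 : ∑ i : Fin n, v i.succ ^ 2 = v 0 ^ 2 := by linarith
  rw [e1, e2] at cs
  have : ∑ i : Fin n, y i.succ * v i.succ < y 0 * v 0 := by
    apply lt_of_pow_lt_pow_left₀ 2 (by positivity)
    nlinarith [pow_pos hv0 2]
  simp only [form] at hf
  linarith

/-- Elements of `Isom n` act on hyperbolic space preserving the distance. -/
theorem hdist_isom {n : ℕ} (g : Isom n) (x y : Space n) :
    hdist ⟨g.1.1 *ᵥ x.1, g.2.2 _ x.2⟩ ⟨g.1.1 *ᵥ y.1, g.2.2 _ y.2⟩ = hdist x y := by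
  simp only [hdist, isom_form g]

/-- Points of the hyperboloid that form a basis of `ℝ^{n+1}`. -/
def frame (n : ℕ) (j : Fin (n + 1)) : Fin (n + 1) → ℝ :=
  Fin.cases (base n) (fun k => Fin.cons (√2) (Pi.single k 1)) j

theorem frame_mem (n : ℕ) (j : Fin (n + 1)) : frame n j ∈ Space n := by
  refine Fin.cases (base_mem n) (fun k => ?_) j
  refine ⟨?_, by simp [frame]⟩
  rw [form_self]
  simp [frame, Pi.single_apply]
  norm_num

/-- The matrix with columns `frame n j`. -/
def frameMatrix (n : ℕ) : Matrix (Fin (n + 1)) (Fin (n + 1)) ℝ :=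
  Matrix.of fun i j => frame n j i

theorem det_frameMatrix (n : ℕ) : (frameMatrix n).det = 1 := by
  rw [Matrix.det_of_isUpperTriangular]
  · refine Finset.prod_eq_one fun i _ => ?_
    refine Fin.cases ?_ (fun k => ?_) i <;> simp [frameMatrix, frame, base]
  · intro i j hij
    simp only [id] at hij
    induction i using Fin.cases with
    | zero => exact absurd hij (by simp)
    | succ i =>
      induction j using Fin.cases with
      | zero => simp [frameMatrix, frame, base]
      | succ j =>
        have : i ≠ j := by rintro rfl; exact lt_irrefl _ hij
        simp [frameMatrix, frame, this]

/-- The Gram matrix of the Lorentzian form. -/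
def gram (n : ℕ) : Matrix (Fin (n + 1)) (Fin (n + 1)) ℝ :=
  Matrix.diagonal (Fin.cons (-1) fun _ => 1)

theorem form_eq_gram {n : ℕ} (x y : Fin (n + 1) → ℝ) : form x y = x ⬝ᵥ (gram n *ᵥ y) := by
  simp [form, gram, dotProduct, Matrix.mulVec_diagonal, Fin.sum_univ_succ]

theorem det_gram (n : ℕ) : (gram n).det ≠ 0 := by
  simp [gram, Matrix.det_diagonal, Fin.prod_univ_succ]

theorem gram_apply {n : ℕ} (A B : Matrix (Fin (n + 1)) (Fin (n + 1)) ℝ) (i j : Fin (n + 1)) :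
    (Aᵀ * gram n * B) i j = form (fun k => A k i) (fun k => B k j) := by
  rw [form_eq_gram, Matrix.mul_assoc, Matrix.mul_apply]
  simp only [dotProduct, Matrix.transpose_apply, Matrix.mul_apply, Matrix.mulVec]

/-- Every distance-preserving self-map of hyperbolic space is the restriction of a unique element
of `Isom n`. -/
theorem existsUnique_isom {n : ℕ} (f : Space n → Space n)
    (hf : ∀ x y, hdist (f x) (f y) = hdist x y) :
    ∃! g : Isom n, ∀ x : Space n, (f x).1 = g.1.1 *ᵥ x.1 := by
  have hform : ∀ x y : Space n, form (f x).1 (f y).1 = form x.1 y.1 := fun x y => by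
    have := Real.arcosh_injOn (one_le_neg_form (f x).2 (f y).2) (one_le_neg_form x.2 y.2)
      (hf x y)
    linarith
  set A := frameMatrix n with hA
  have hAdet : A.det = 1 := det_frameMatrix n
  have hAu : IsUnit A.det := by rw [hAdet]; exact isUnit_one
  let X : Fin (n + 1) → Space n := fun j => ⟨frame n j, frame_mem n j⟩
  let B : Matrix (Fin (n + 1)) (Fin (n + 1)) ℝ := Matrix.of fun i j => (f (X j)).1 i
  have hgram : Bᵀ * gram n * B = Aᵀ * gram n * A := by
    ext i j
    rw [gram_apply, gram_apply]
    exact hform (X i) (X j)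
  have hBdet : B.det ≠ 0 := by
    intro h
    have := congrArg Matrix.det hgram
    simp only [Matrix.det_mul, Matrix.det_transpose, h, hAdet] at this
    exact det_gram n (by linarith)
  have hB : IsUnit B.det := isUnit_iff_ne_zero.2 hBdet
  let M : Matrix (Fin (n + 1)) (Fin (n + 1)) ℝ := B * A⁻¹
  have hMA : M * A = B := by
    simp only [M, Matrix.mul_assoc, Matrix.nonsing_inv_mul A hAu, Matrix.mul_one]
  have hMdet : M.det ≠ 0 := by
    intro h
    have := congrArg Matrix.det hMA
    rw [Matrix.det_mul, h, zero_mul] at this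
    exact hBdet this.symm
  have hMg : Mᵀ * gram n * M = gram n := by
    have h1 : Mᵀ * gram n * M = (A⁻¹)ᵀ * (Bᵀ * gram n * B) * A⁻¹ := by
      simp only [M, Matrix.transpose_mul, Matrix.mul_assoc]
    rw [h1, hgram]
    have h2 : (A⁻¹)ᵀ * Aᵀ = 1 := by
      rw [← Matrix.transpose_mul, Matrix.mul_nonsing_inv A hAu, Matrix.transpose_one]
    calc (A⁻¹)ᵀ * (Aᵀ * gram n * A) * A⁻¹
        = ((A⁻¹)ᵀ * Aᵀ) * gram n * (A * A⁻¹) := by simp only [Matrix.mul_assoc]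
      _ = gram n := by rw [h2, Matrix.mul_nonsing_inv A hAu, Matrix.one_mul, Matrix.mul_one]
  have hMform : ∀ x y, form (M *ᵥ x) (M *ᵥ y) = form x y := fun x y => by
    have e : x ⬝ᵥ ((Mᵀ * gram n * M) *ᵥ y) = (M *ᵥ x) ⬝ᵥ (gram n *ᵥ (M *ᵥ y)) := by
      simp only [← Matrix.mulVec_mulVec, Matrix.dotProduct_mulVec, Matrix.vecMul_transpose]
    rw [form_eq_gram, form_eq_gram, ← e, hMg]
  have hMX : ∀ j, M *ᵥ (X j).1 = (f (X j)).1 := fun j => by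
    ext i
    have := congrFun (congrFun hMA i) j
    rw [Matrix.mul_apply] at this
    exact this
  have hfM : ∀ x : Space n, (f x).1 = M *ᵥ x.1 := fun x => by
    have h : ∀ j, form ((f x).1 - M *ᵥ x.1) (f (X j)).1 = 0 := fun j => by
      rw [form_sub_left, hform, ← hMX, hMform, sub_self]
    have h2 : (Bᵀ * gram n) *ᵥ ((f x).1 - M *ᵥ x.1) = 0 := by
      ext j
      rw [← Matrix.mulVec_mulVec]
      have := h j
      rw [form_comm, form_eq_gram] at this
      exact this
    have h3 : IsUnit (Bᵀ * gram n).det := by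
      rw [Matrix.det_mul, Matrix.det_transpose]
      exact isUnit_iff_ne_zero.2 (mul_ne_zero hBdet (det_gram n))
    have h4 := Matrix.eq_zero_of_mulVec_eq_zero h3.ne_zero h2
    exact sub_eq_zero.1 h4
  refine ⟨⟨Matrix.GeneralLinearGroup.mkOfDetNeZero M hMdet, hMform, fun x hx => ?_⟩, hfM, ?_⟩
  · have := (f ⟨x, hx⟩).2
    rwa [hfM] at this
  · intro g hg
    apply Subtype.ext
    apply Units.ext
    have h1 : g.1.1 * A = B := by
      ext i j
      rw [Matrix.mul_apply]
      exact (congrFun (hg (X j)) i).symm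
    change g.1.1 = M
    calc g.1.1 = g.1.1 * A * A⁻¹ := by
          rw [Matrix.mul_assoc, Matrix.mul_nonsing_inv A hAu, Matrix.mul_one]
      _ = M := by rw [h1]

/-- The boundary at infinity of hyperbolic `n`-space: the unit sphere of `ℝ^n`, where the unit
vector `b` stands for the light ray through `(1, b)`. -/
abbrev Boundary (n : ℕ) : Type := Metric.sphere (0 : EuclideanSpace ℝ (Fin n)) 1

/-- The lightlike vector `(1, b)` representing the boundary point `b`. -/
def lightVec {n : ℕ} (b : Boundary n) : Fin (n + 1) → ℝ :=
  Fin.cons 1 fun i => b.1 i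

theorem sum_sq_boundary {n : ℕ} (b : Boundary n) : ∑ i, b.1 i ^ 2 = 1 := by
  have h := b.2
  rw [mem_sphere_zero_iff_norm] at h
  have := EuclideanSpace.real_norm_sq_eq b.1
  rw [h] at this
  linarith

theorem form_lightVec {n : ℕ} (b : Boundary n) : form (lightVec b) (lightVec b) = 0 := by
  rw [form_self]
  simp [lightVec, sum_sq_boundary b]

/-- The boundary point of a future-pointing lightlike vector `v`, that is,
`(v₁ / v₀, …, vₙ / v₀)`. -/
def ofLight {n : ℕ} (v : Fin (n + 1) → ℝ) (hv : form v v = 0) (hv0 : 0 < v 0) : Boundary n :=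
  ⟨WithLp.toLp 2 fun i => v i.succ / v 0, by
    rw [mem_sphere_zero_iff_norm]
    have h : ‖(WithLp.toLp 2 fun i => v i.succ / v 0 : EuclideanSpace ℝ (Fin n))‖ ^ 2 = 1 := by
      rw [EuclideanSpace.real_norm_sq_eq]
      simp only [div_pow, ← Finset.sum_div]
      rw [form_self] at hv
      rw [div_eq_one_iff_eq (by positivity)]
      linarith
    exact (pow_eq_one_iff_of_nonneg (norm_nonneg _) two_ne_zero).1 h⟩

theorem lightVec_ofLight {n : ℕ} (v : Fin (n + 1) → ℝ) (hv : form v v = 0) (hv0 : 0 < v 0) :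
    lightVec (ofLight v hv hv0) = (v 0)⁻¹ • v := by
  ext i
  refine Fin.cases ?_ (fun k => ?_) i
  · simp [lightVec, hv0.ne']
  · simp [lightVec, ofLight, div_eq_inv_mul]

theorem lightVec_injective {n : ℕ} : Function.Injective (lightVec (n := n)) := by
  intro b c h
  apply Subtype.ext
  ext i
  have := congrFun h i.succ
  simpa [lightVec] using this

/-- The action of `Isom n` on the boundary, through its linear action on light rays. -/
instance (n : ℕ) : SMul (Isom n) (Boundary n) where
  smul g b := ofLight (g.1.1 *ᵥ lightVec b)
    (by rw [isom_form g, form_lightVec])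
    (isom_time_pos g (form_lightVec b) (by simp [lightVec]))

theorem lightVec_smul {n : ℕ} (g : Isom n) (b : Boundary n) :
    lightVec (g • b) = ((g.1.1 *ᵥ lightVec b) 0)⁻¹ • (g.1.1 *ᵥ lightVec b) :=
  lightVec_ofLight _ _ _

instance (n : ℕ) : MulAction (Isom n) (Boundary n) where
  one_smul b := by
    apply lightVec_injective
    rw [lightVec_smul]
    simp [lightVec]
  mul_smul g h b := by
    apply lightVec_injective
    have hb := isom_time_pos h (form_lightVec b) (by simp [lightVec])
    rw [lightVec_smul, lightVec_smul, lightVec_smul, Matrix.mulVec_smul,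
      Subgroup.coe_mul, Units.val_mul, ← Matrix.mulVec_mulVec, smul_smul]
    congr 1
    simp only [Pi.smul_apply, smul_eq_mul, mul_inv, inv_inv]
    rw [mul_right_comm, mul_inv_cancel₀ hb.ne', one_mul]

/-- The Lebesgue (surface) measure on the boundary sphere. -/
def boundaryMeasure (n : ℕ) : Measure (Boundary n) :=
  (volume : Measure (EuclideanSpace ℝ (Fin n))).toSphere

/-- The group of orientation-preserving isometries of hyperbolic `n`-space. -/
def IsomPlus (n : ℕ) : Subgroup (Isom n) where
  carrier := {g | 0 < g.1.1.det}
  one_mem' := by simp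
  mul_mem' := by
    intro a b ha hb
    simpa [Matrix.det_mul] using mul_pos ha hb
  inv_mem' := by
    intro a ha
    have h : a.1.1.det * (a⁻¹).1.1.det = 1 := by
      rw [← Matrix.det_mul, ← Units.val_mul, ← Subgroup.coe_mul]; simp
    have ha' : 0 < a.1.1.det := ha
    exact pos_of_mul_pos_right (by rw [h]; exact one_pos) ha'.le

instance (n : ℕ) : MeasurableSpace (IsomPlus n) := borel _

instance (n : ℕ) : BorelSpace (IsomPlus n) := ⟨rfl⟩

theorem isClosed_space (n : ℕ) : IsClosed (Space n) := by
  have : Space n = {x | form x x = -1} ∩ {x | 1 ≤ x 0} := by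
    ext x
    exact ⟨fun h => ⟨h.1, one_le_of_mem h⟩, fun h => ⟨h.1, lt_of_lt_of_le one_pos h.2⟩⟩
  rw [this]
  refine IsClosed.inter (isClosed_eq ?_ continuous_const)
    (isClosed_le continuous_const (continuous_apply 0))
  unfold form
  fun_prop

theorem isClosed_isom (n : ℕ) : IsClosed (Isom n : Set (GL (Fin (n + 1)) ℝ)) := by
  have hc : ∀ x : Fin (n + 1) → ℝ, Continuous fun g : GL (Fin (n + 1)) ℝ => g.1 *ᵥ x :=
    fun x => Units.continuous_val.matrix_mulVec continuous_const
  have : (Isom n : Set (GL (Fin (n + 1)) ℝ)) =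
      (⋂ x, ⋂ y, {g | form (g.1 *ᵥ x) (g.1 *ᵥ y) = form x y}) ∩
        ⋂ x ∈ Space n, {g | g.1 *ᵥ x ∈ Space n} := by
    ext g
    simp [Isom]
  rw [this]
  refine IsClosed.inter (isClosed_iInter fun x => isClosed_iInter fun y =>
    isClosed_eq ?_ continuous_const)
    (isClosed_iInter fun x => isClosed_iInter fun _ => (isClosed_space n).preimage (hc x))
  have h1 := hc x
  have h2 := hc y
  unfold form
  fun_prop

instance (n : ℕ) : LocallyCompactSpace (Isom n) :=
  haveI : LocallyCompactSpace (Matrix (Fin (n + 1)) (Fin (n + 1)) ℝ) :=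
    inferInstanceAs (LocallyCompactSpace (Fin (n + 1) → Fin (n + 1) → ℝ))
  (isClosed_isom n).isClosedEmbedding_subtypeVal.locallyCompactSpace

instance (n : ℕ) : LocallyCompactSpace (IsomPlus n) := by
  have : IsOpen (IsomPlus n : Set (Isom n)) :=
    isOpen_lt continuous_const
      ((Units.continuous_val.comp continuous_subtype_val).matrix_det)
  exact this.isOpenEmbedding_subtypeVal.locallyCompactSpace

/-- The determinant of the vectors `(1, b₀), …, (1, bₙ)`. In the projective (Klein) model the
ideal geodesic simplex with vertices `b₀, …, bₙ` is the Euclidean simplex on these points, and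
this is `n!` times its signed Euclidean volume. -/
def orientation {n : ℕ} (σ : Fin (n + 1) → Boundary n) : ℝ :=
  Matrix.det (Matrix.of fun i => lightVec (σ i))

/-- Vertex tuples of regular ideal `n`-simplices: the simplex is nondegenerate, and each
permutation of its vertices is realized by an isometry of hyperbolic space. -/
def RegularIdeal (n : ℕ) : Set (Fin (n + 1) → Boundary n) :=
  {σ | orientation σ ≠ 0 ∧
    ∀ π : Equiv.Perm (Fin (n + 1)), ∃ g : Isom n, ∀ i, g • σ i = σ (π i)}

/-- Vertex tuples of positively oriented regular ideal `n`-simplices. -/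
def RegularIdealPos (n : ℕ) : Set (Fin (n + 1) → Boundary n) :=
  {σ | σ ∈ RegularIdeal n ∧ 0 < orientation σ}

theorem measurable_orbit {n : ℕ} (σ : Fin (n + 1) → Boundary n) :
    Measurable fun (g : IsomPlus n) i => g • σ i := by
  refine measurable_pi_lambda _ fun i => Continuous.measurable ?_
  have hc : Continuous fun g : IsomPlus n => g.1.1.1 *ᵥ lightVec (σ i) :=
    (Units.continuous_val.comp
      (continuous_subtype_val.comp continuous_subtype_val)).matrix_mulVec continuous_const
  refine Continuous.subtype_mk ((PiLp.continuous_toLp 2 _).comp (continuous_pi fun k => ?_)) _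
  exact ((continuous_apply k.succ).comp hc).div ((continuous_apply 0).comp hc) fun g =>
    (isom_time_pos g.1 (form_lightVec (σ i)) (by simp [lightVec])).ne'

/-- For `σ ∈ RegularIdealPos n`, the natural measure on positively oriented regular ideal simplices
(seen as a measure on all vertex tuples): the image of Haar measure on `IsomPlus n` under the orbit
map `g ↦ g σ`. -/
def regularMeasure {n : ℕ} (σ : Fin (n + 1) → Boundary n) : Measure (Fin (n + 1) → Boundary n) :=
  Measure.map (fun (g : IsomPlus n) i => g • σ i) Measure.haar

/-- `ρ` is the reflection in the face of `σ` opposite to the vertex `i`: the nonidentity isometry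
that fixes each point of the hyperbolic hyperplane spanned by the other vertices. -/
def IsFaceReflection {n : ℕ} (σ : Fin (n + 1) → Boundary n) (i : Fin (n + 1)) (ρ : Isom n) :
    Prop :=
  ρ ≠ 1 ∧ ∀ x ∈ Space n,
    x ∈ Submodule.span ℝ ((fun j => lightVec (σ j)) '' {j | j ≠ i}) → ρ.1.1 *ᵥ x = x

/-- The group generated by the reflections in the codimension-one faces of `σ`. -/
def reflectionGroup {n : ℕ} (σ : Fin (n + 1) → Boundary n) : Subgroup (Isom n) :=
  Subgroup.closure {ρ | ∃ i, IsFaceReflection σ i ρ}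

end Hyperbolic

end

/-! Rescaling the light vectors of the vertices of a regular ideal simplex makes all their mutual
products equal to -1 (`RegularIdeal.isFrame`). All such frames have the same Gram matrix, so `Isom
n` acts simply transitively on regular ideal simplices, and two of them that differ in a single
vertex are mirror images in the common face (`RegularIdeal.eq_or_eq_refl`).

For part (1), almost every g has a unique isometry `f g` with `φ (g • σ i) = f g • σ i` for all i.
The h with f(gh) = f(g)h for almost all g form a subgroup, `commutant f`. It contains each face
reflection ρ: the simplices gσ and gρσ share a face, hence so do their images, and these differ
because φ respects orientation. Once the commutant is dense (`dense_commutant`), f(g)g⁻¹ agrees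
almost everywhere with a measurable function that is almost invariant under a dense set of right
translations. Such a function is almost everywhere constant, because translation is continuous in
measure and the group acts ergodically on itself. Hence f(g) = g₀g, so φ = g₀ at gσ₀ for almost
every g, and Fubini turns this into almost every boundary point.

Density is also part (2). Let K be a closed group that contains the face reflections. For n > 3 the
normals of two faces make an angle with cosine -1/(n-1), by Niven's theorem not a rational multiple
of π, so K contains full circles of rotations. Their velocities at a spacelike vector u span,
together with u, the whole space; hence K has open orbits on spacelike rays. Spacelike vectors form
a connected set, so K is transitive on these rays, conjugates one reflection to all others, and is
everything.

For n = 3 the dihedral angle is π/3 and the reflection group is discrete, so one more element is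
needed: the hyperbolic translation by log 2 along an edge. It carries the vertices of σ to vertices
of the tiling by reflected copies of σ, which is enough to place it in the commutant. Conjugation by
it doubles parabolic translations at an end of the edge, so a closed group containing it and one
such parabolic contains the whole one-parameter group, and the argument with open orbits applies
again. -/

noncomputable section

/-! ### Almost invariance under a dense set of translations. -/

section Ergodic

open Filter Topology symmDiff Pointwise

variable {G : Type*} [Group G] [TopologicalSpace G] [IsTopologicalGroup G] [LocallyCompactSpace G]
  [SecondCountableTopology G] [MeasurableSpace G] [BorelSpace G]
  {μ : Measure G} [μ.IsHaarMeasure]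

/-- A measurable set that is almost invariant under left multiplication by a dense set of elements
of a locally compact group is null or conull. -/
theorem aeconst_of_dense_preimage_mul_left {S : Set G} (hS : MeasurableSet S)
    (hd : Dense {h : G | (fun g => h * g) ⁻¹' S =ᵐ[μ] S}) : EventuallyConst S (ae μ) := by
  refine aeconst_of_forall_preimage_smul_ae_eq G hS.nullMeasurableSet fun x => ?_
  rw [← measure_symmDiff_eq_zero_iff]
  set D := ((x • ·) ⁻¹' S) ∆ S with hD
  have hcomp : ∀ C : Set G, IsCompact C → μ (D ∩ C) = 0 := by
    intro C hC
    by_contra hne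
    obtain ⟨V, hV, hVx⟩ := exists_compact_mem_nhds x
    -- Continuity of translation in measure requires finite measure; this truncation is invisible on
    -- C for translations by elements of V.
    set T := S ∩ closure (V * C) with hT
    have hTm : MeasurableSet T := hS.inter isClosed_closure.measurableSet
    have hTfin : μ T ≠ ⊤ := ((measure_mono Set.inter_subset_right).trans_lt
      (hV.mul hC).closure.measure_lt_top).ne
    let F : C(G × G, G) := ⟨fun p => p.1 * p.2, continuous_mul⟩
    have htend := tendsto_measure_symmDiff_preimage_nhds_zero (μ := μ) (ν := μ)
      (f := fun y => F.curry y) (g := F.curry x) (l := 𝓝 x) (F.curry.continuous.tendsto x)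
      (Eventually.of_forall fun y => measurePreserving_mul_left μ y)
      (measurePreserving_mul_left μ x) hTm.nullMeasurableSet hTfin
    have hev := (htend.eventually (gt_mem_nhds (pos_iff_ne_zero.2 hne))).and hVx
    obtain ⟨y, hyd, hy, hyV⟩ := hd.inter_nhds_nonempty hev
    -- On D ∩ C, y preserves membership in S while x changes it, so almost all of D ∩ C lies in the
    -- symmetric difference that was made small.
    refine absurd hy (not_lt.2 (measure_mono_ae ?_))
    have hyd' : (fun g => y * g) ⁻¹' S =ᵐ[μ] S := hyd
    filter_upwards [hyd'.mem_iff] with g hg hgD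
    obtain ⟨hgD, hgC⟩ := hgD
    have hxm : x * g ∈ closure (V * C) :=
      subset_closure (Set.mul_mem_mul (mem_of_mem_nhds hVx) hgC)
    have hym : y * g ∈ closure (V * C) := subset_closure (Set.mul_mem_mul hyV hgC)
    have hg' : y * g ∈ S ↔ g ∈ S := hg
    have hgD' : (x * g ∈ S ∧ g ∉ S) ∨ (g ∈ S ∧ x * g ∉ S) := hgD
    change (y * g ∈ T ∧ x * g ∉ T) ∨ (x * g ∈ T ∧ y * g ∉ T)
    simp only [hT, Set.mem_inter_iff, hxm, hym, and_true, hg']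
    tauto
  have : D = ⋃ m, D ∩ compactCovering G m := by
    rw [← Set.inter_iUnion, iUnion_compactCovering, Set.inter_univ]
  rw [this, measure_iUnion_null_iff]
  exact fun m => hcomp _ (isCompact_compactCovering G m)

/-- A measurable function that is almost invariant under right multiplication by a dense set of
elements of a locally compact group is almost everywhere constant. -/
theorem exists_ae_eq_const_of_dense_mul_right {F : G → ℝ} (hF : Measurable F)
    (hd : Dense {h : G | ∀ᵐ g ∂μ, F (g * h) = F g}) : ∃ c, ∀ᵐ g ∂μ, F g = c := by
  refine exists_eventuallyEq_const_of_forall_separating MeasurableSet fun U hU => ?_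
  -- Inversion preserves null sets and exchanges right and left translations.
  have hS : MeasurableSet ((fun g => F g⁻¹) ⁻¹' U) := (hF.comp measurable_inv) hU
  have hd' : Dense {h : G | (fun g => h * g) ⁻¹' ((fun g => F g⁻¹) ⁻¹' U) =ᵐ[μ]
      ((fun g => F g⁻¹) ⁻¹' U)} := by
    refine (hd.preimage (Homeomorph.inv G).isOpenMap).mono fun h hh => ?_
    have hh' : ∀ᵐ g ∂μ, F (g * h⁻¹) = F g := hh
    have := (quasiMeasurePreserving_inv μ).ae hh'
    rw [Set.mem_ofPred_eq, eventuallyEq_set]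
    filter_upwards [this] with g hg
    rw [Set.mem_preimage, Set.mem_preimage, Set.mem_preimage, mul_inv_rev, hg]
  have hinv : ∀ p : G → Prop, (∀ᵐ g ∂μ, p g⁻¹) → ∀ᵐ g ∂μ, p g := fun p hp => by
    simpa only [inv_inv] using (quasiMeasurePreserving_inv μ).ae hp
  rcases eventuallyConst_set.1 (aeconst_of_dense_preimage_mul_left hS hd') with h | h
  · exact Or.inl (hinv _ h)
  · exact Or.inr (hinv _ h)

end Ergodic

namespace Hyperbolic

variable {n : ℕ}

/-! ### Lorentzian linear algebra and time orientation. -/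

theorem form_add_left (x y z : Fin (n + 1) → ℝ) : form (x + y) z = form x z + form y z := by
  simp only [form, Pi.add_apply, add_mul, Finset.sum_add_distrib]; ring

theorem form_add_right (x y z : Fin (n + 1) → ℝ) : form x (y + z) = form x y + form x z := by
  rw [form_comm, form_add_left, form_comm y, form_comm z]

theorem form_smul_left (c : ℝ) (x y : Fin (n + 1) → ℝ) : form (c • x) y = c * form x y := by
  simp only [form, Pi.smul_apply, smul_eq_mul, mul_add, Finset.mul_sum, mul_assoc, mul_neg]

theorem form_smul_right (c : ℝ) (x y : Fin (n + 1) → ℝ) : form x (c • y) = c * form x y := by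
  rw [form_comm, form_smul_left, form_comm y]

theorem form_sub_right (x y z : Fin (n + 1) → ℝ) : form x (y - z) = form x y - form x z := by
  rw [form_comm, form_sub_left, form_comm y, form_comm z]

theorem form_neg_left (x y : Fin (n + 1) → ℝ) : form (-x) y = -form x y := by
  rw [← neg_one_smul ℝ x, form_smul_left, neg_one_mul]

theorem form_neg_right (x y : Fin (n + 1) → ℝ) : form x (-y) = -form x y := by
  rw [form_comm, form_neg_left, form_comm y]

theorem form_zero_left (x : Fin (n + 1) → ℝ) : form 0 x = 0 := by simp [form]

theorem form_sum_left {ι : Type*} (s : Finset ι) (f : ι → Fin (n + 1) → ℝ)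
    (y : Fin (n + 1) → ℝ) : form (∑ i ∈ s, f i) y = ∑ i ∈ s, form (f i) y := by
  classical
  induction s using Finset.induction_on with
  | empty => simp [form_zero_left]
  | insert a s ha ih => rw [Finset.sum_insert ha, Finset.sum_insert ha, form_add_left, ih]

theorem form_sum_right {ι : Type*} (s : Finset ι) (f : ι → Fin (n + 1) → ℝ)
    (y : Fin (n + 1) → ℝ) : form y (∑ i ∈ s, f i) = ∑ i ∈ s, form y (f i) := by
  simp only [form_comm y, form_sum_left]

theorem eq_zero_of_form_eq_zero {x : Fin (n + 1) → ℝ} (h : ∀ y, form x y = 0) : x = 0 := by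
  ext i
  have hi := h (Pi.single i 1)
  induction i using Fin.cases with
  | zero => simpa [form] using hi
  | succ k => simpa [form, Pi.single_apply] using hi

theorem continuous_form : Continuous fun p : (Fin (n + 1) → ℝ) × (Fin (n + 1) → ℝ) =>
    form p.1 p.2 := by
  unfold form
  fun_prop

/-- The form is negative on a timelike and a causal future vector. -/
theorem form_neg_of_future {x v : Fin (n + 1) → ℝ} (hx : form x x < 0) (hx0 : 0 < x 0)
    (hv : form v v ≤ 0) (hv0 : 0 < v 0) : form x v < 0 := by
  rw [form_self] at hx hv
  have cs := Finset.sum_mul_sq_le_sq_mul_sq Finset.univ (fun i : Fin n => x i.succ)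
    (fun i : Fin n => v i.succ)
  have hA : 0 ≤ ∑ i : Fin n, x i.succ ^ 2 := Finset.sum_nonneg fun i _ => sq_nonneg _
  have hB : 0 ≤ ∑ i : Fin n, v i.succ ^ 2 := Finset.sum_nonneg fun i _ => sq_nonneg _
  have : ∑ i : Fin n, x i.succ * v i.succ < x 0 * v 0 := by
    apply lt_of_pow_lt_pow_left₀ 2 (by positivity)
    have h1 : (∑ i : Fin n, x i.succ ^ 2) * ∑ i : Fin n, v i.succ ^ 2
        ≤ (∑ i : Fin n, x i.succ ^ 2) * v 0 ^ 2 :=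
      mul_le_mul_of_nonneg_left (by linarith) hA
    have h2 : (∑ i : Fin n, x i.succ ^ 2) * v 0 ^ 2 < x 0 ^ 2 * v 0 ^ 2 :=
      mul_lt_mul_of_pos_right (by linarith) (by positivity)
    rw [mul_pow]
    linarith
  simp only [form]
  linarith

theorem time_ne_zero {x : Fin (n + 1) → ℝ} (hx : form x x < 0) : x 0 ≠ 0 := by
  intro h0
  have : 0 ≤ form x x := by
    simp only [form, h0, mul_zero, neg_zero, zero_add]
    exact Finset.sum_nonneg fun i _ => mul_self_nonneg _
  linarith

/-- A timelike vector is future-pointing as soon as its product with some causal future vector is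
negative. -/
theorem time_pos_of_form_neg {x v : Fin (n + 1) → ℝ} (hx : form x x < 0)
    (hv : form v v ≤ 0) (hv0 : 0 < v 0) (h : form x v < 0) : 0 < x 0 := by
  by_contra hneg
  have h1 := lt_of_le_of_ne (not_lt.1 hneg) (time_ne_zero hx)
  have := form_neg_of_future (x := -x) (by rwa [form_neg_neg]) (by simpa using h1) hv hv0
  rw [form_neg_left] at this
  linarith

/-! ### Isometries and reflections as linear maps. -/

/-- The linear action of isometries on `ℝ^{n+1}`. -/
def lin (n : ℕ) : Isom n →* Module.End ℝ (Fin (n + 1) → ℝ) where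
  toFun g := Matrix.mulVecLin g.1.1
  map_one' := by simp; rfl
  map_mul' g h := by simp [Matrix.mulVecLin_mul]; rfl

theorem lin_apply (g : Isom n) (x : Fin (n + 1) → ℝ) : lin n g x = g.1.1 *ᵥ x := rfl

theorem form_lin (g : Isom n) (x y : Fin (n + 1) → ℝ) : form (lin n g x) (lin n g y) = form x y :=
  isom_form g x y

theorem lin_mem_space (g : Isom n) {x : Fin (n + 1) → ℝ} (hx : x ∈ Space n) :
    lin n g x ∈ Space n := g.2.2 x hx

theorem lin_injective : Function.Injective (lin n) := by
  intro g h hgh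
  apply Subtype.ext
  apply Units.ext
  exact Matrix.toLin'.injective (by rw [Matrix.toLin'_apply', Matrix.toLin'_apply']; exact hgh)

theorem lin_mul_apply (g h : Isom n) (x : Fin (n + 1) → ℝ) :
    lin n (g * h) x = lin n g (lin n h x) := by
  rw [map_mul]; rfl

theorem lin_one_apply (x : Fin (n + 1) → ℝ) : lin n 1 x = x := by
  rw [map_one]; rfl

theorem lin_inv_apply_self (g : Isom n) (x : Fin (n + 1) → ℝ) : lin n g⁻¹ (lin n g x) = x := by
  rw [← lin_mul_apply, inv_mul_cancel, lin_one_apply]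

theorem lin_apply_inv_self (g : Isom n) (x : Fin (n + 1) → ℝ) : lin n g (lin n g⁻¹ x) = x := by
  rw [← lin_mul_apply, mul_inv_cancel, lin_one_apply]

theorem form_lin_left (g : Isom n) (x y : Fin (n + 1) → ℝ) :
    form (lin n g x) y = form x (lin n g⁻¹ y) := by
  rw [← form_lin g x, lin_apply_inv_self]

/-- An endomorphism that preserves the form and maps some causal future vector to a causal future
vector is an isometry. -/
theorem exists_isom_of_linear (L : Module.End ℝ (Fin (n + 1) → ℝ))
    (hL : ∀ x y, form (L x) (L y) = form x y) {v : Fin (n + 1) → ℝ} (hv : form v v ≤ 0)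
    (hv0 : 0 < v 0) (hLv : 0 < L v 0) : ∃ g : Isom n, lin n g = L := by
  have hinj : Function.Injective L := by
    rw [injective_iff_map_eq_zero]
    intro x hx
    refine eq_zero_of_form_eq_zero fun y => ?_
    rw [← hL, hx, form_zero_left]
  have hdet : (LinearMap.toMatrix' L).det ≠ 0 := by
    rw [LinearMap.det_toMatrix']
    exact (LinearMap.isUnit_iff_isUnit_det _).1
      ((Module.End.isUnit_iff _).2 ⟨hinj, LinearMap.injective_iff_surjective.1 hinj⟩) |>.ne_zero
  have happ : ∀ x, LinearMap.toMatrix' L *ᵥ x = L x := fun x => LinearMap.toMatrix'_mulVec L x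
  refine ⟨⟨Matrix.GeneralLinearGroup.mkOfDetNeZero _ hdet, fun x y => ?_, fun x hx => ?_⟩, ?_⟩
  · change form (LinearMap.toMatrix' L *ᵥ x) (LinearMap.toMatrix' L *ᵥ y) = _
    rw [happ, happ, hL]
  · change LinearMap.toMatrix' L *ᵥ x ∈ _
    rw [happ]
    have h1 : form (L x) (L x) = -1 := by rw [hL, hx.1]
    refine ⟨h1, time_pos_of_form_neg (by linarith) (by rwa [hL]) hLv ?_⟩
    rw [hL]
    exact form_neg_of_future (by linarith [hx.1]) hx.2 hv hv0
  · ext1 x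
    ext1
    change (LinearMap.toMatrix' L).mulVecLin _ = _
    rw [← Matrix.toLin'_apply', Matrix.toLin'_toMatrix']
    rfl

/-- The reflection in the hyperplane orthogonal to `e`. -/
def reflLin (e : Fin (n + 1) → ℝ) : Module.End ℝ (Fin (n + 1) → ℝ) where
  toFun x := x - (2 * form x e / form e e) • e
  map_add' x y := by
    rw [form_add_left, mul_add, add_div, add_smul]; abel
  map_smul' c x := by
    rw [form_smul_left, RingHom.id_apply, smul_sub, smul_smul]
    congr 2; ring

theorem exists_refl {e : Fin (n + 1) → ℝ} (he : 0 < form e e) :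
    ∃ g : Isom n, lin n g = reflLin e := by
  have hform : ∀ x y, form (reflLin e x) (reflLin e y) = form x y := fun x y => by
    simp only [reflLin, LinearMap.coe_mk, AddHom.coe_mk, form_sub_left, form_sub_right,
      form_smul_left, form_smul_right, form_comm e y]
    field_simp
    ring
  refine exists_isom_of_linear _ hform (v := base n) (by linarith [(base_mem n).1])
    (base_mem n).2 ?_
  -- With R the reflection and o the base point, ⟨Ro, o⟩ = -1 - 2⟨o, e⟩²/⟨e, e⟩ is negative, so Ro
  -- is again future-pointing.
  refine time_pos_of_form_neg (v := base n) (by linarith [hform (base n) (base n), (base_mem n).1])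
    (by linarith [(base_mem n).1]) (base_mem n).2 ?_
  simp only [reflLin, LinearMap.coe_mk, AddHom.coe_mk, form_sub_left, form_smul_left,
    (base_mem n).1, form_comm e]
  have : 0 ≤ 2 * form (base n) e / form e e * form (base n) e := by
    rw [div_mul_eq_mul_div]
    apply div_nonneg _ he.le
    nlinarith [mul_self_nonneg (form (base n) e)]
  linarith

/-- The reflection in the hyperplane orthogonal to a spacelike vector, as an isometry. -/
def refl {e : Fin (n + 1) → ℝ} (he : 0 < form e e) : Isom n := (exists_refl he).choose

theorem lin_refl {e : Fin (n + 1) → ℝ} (he : 0 < form e e) (x : Fin (n + 1) → ℝ) :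
    lin n (refl he) x = x - (2 * form x e / form e e) • e := by
  rw [refl, (exists_refl he).choose_spec]; rfl

theorem isom_ext {g h : Isom n} (H : ∀ x, lin n g x = lin n h x) : g = h :=
  lin_injective (LinearMap.ext H)

theorem conj_refl (g : Isom n) {e : Fin (n + 1) → ℝ} (he : 0 < form e e)
    (he' : 0 < form (lin n g e) (lin n g e)) : g * refl he * g⁻¹ = refl he' := by
  refine isom_ext fun x => ?_
  rw [lin_mul_apply, lin_mul_apply, lin_refl, lin_refl, map_sub, map_smul, lin_apply_inv_self,
    form_lin, form_comm x, form_lin_left, form_comm e, inv_inv, form_comm x]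

theorem refl_smul {c : ℝ} (hc : c ≠ 0) {e : Fin (n + 1) → ℝ} (he : 0 < form e e)
    (he' : 0 < form (c • e) (c • e)) : refl he' = refl he := by
  refine isom_ext fun x => ?_
  rw [lin_refl, lin_refl, smul_smul]
  simp only [form_smul_left, form_smul_right]
  congr 2
  field_simp

/-- The reflection that interchanges two vectors of equal length. -/
theorem lin_refl_sub {x y : Fin (n + 1) → ℝ} (hxy : form x x = form y y)
    (he : 0 < form (x - y) (x - y)) : lin n (refl he) x = y := by
  rw [lin_refl]
  have h : 2 * form x (x - y) = form (x - y) (x - y) := by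
    simp only [form_sub_left, form_sub_right, form_comm y x]; linarith
  rw [h, div_self he.ne', one_smul, sub_sub_cancel]

/-! ### Frames: light vectors with constant mutual products. -/

/-- A normalized system of light vectors representing the vertices of a regular ideal simplex. -/
structure IsFrame (v : Fin (n + 1) → Fin (n + 1) → ℝ) : Prop where
  self : ∀ i, form (v i) (v i) = 0
  cross : ∀ i j, i ≠ j → form (v i) (v j) = -1
  pos : ∀ i, 0 < v i 0

namespace IsFrame

variable {v w : Fin (n + 1) → Fin (n + 1) → ℝ}

theorem form_eq (hv : IsFrame v) (i j : Fin (n + 1)) :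
    form (v i) (v j) = (if i = j then 1 else 0) - 1 := by
  split_ifs with h
  · rw [h, hv.self, sub_self]
  · rw [hv.cross i j h, zero_sub]

theorem form_sum (hv : IsFrame v) (i : Fin (n + 1)) : form (v i) (∑ j, v j) = -n := by
  simp [form_sum_right, hv.form_eq]

theorem comp_perm (hv : IsFrame v) (π : Equiv.Perm (Fin (n + 1))) : IsFrame (v ∘ π) :=
  ⟨fun _ => hv.self _, fun _ _ h => hv.cross _ _ (π.injective.ne h), fun _ => hv.pos _⟩

theorem lin (hv : IsFrame v) (g : Isom n) : IsFrame fun i => Hyperbolic.lin n g (v i) :=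
  ⟨fun i => by rw [form_lin, hv.self], fun i j h => by rw [form_lin, hv.cross i j h],
    fun i => isom_time_pos g (hv.self i) (hv.pos i)⟩

/-- The normal vector to the span of all vectors of a frame but one. -/
def normal (v : Fin (n + 1) → Fin (n + 1) → ℝ) (i : Fin (n + 1)) : Fin (n + 1) → ℝ :=
  v i - (1 / n : ℝ) • ∑ j, v j

/-- The normals are the basis dual to the frame, so all coordinates with respect to a frame are read
off from them. -/
theorem form_normal (hn : 1 ≤ n) (hv : IsFrame v) (i k : Fin (n + 1)) :
    form (v k) (normal v i) = if k = i then 1 else 0 := by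
  have : (n : ℝ) ≠ 0 := by positivity
  rw [normal, form_sub_right, form_smul_right, hv.form_sum, hv.form_eq]
  field_simp
  ring

theorem form_normal_normal (hn : 1 ≤ n) (hv : IsFrame v) (i k : Fin (n + 1)) :
    form (normal v i) (normal v k) = (if i = k then 1 else 0) - 1 / n := by
  rw [normal, form_sub_left, form_smul_left, form_sum_left]
  simp [hv.form_normal hn]

theorem normal_pos (hn : 2 ≤ n) (hv : IsFrame v) (i : Fin (n + 1)) :
    0 < form (normal v i) (normal v i) := by
  rw [hv.form_normal_normal (by omega), if_pos rfl, sub_pos, div_lt_one (by positivity)]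
  exact_mod_cast hn

theorem linearIndependent (hn : 1 ≤ n) (hv : IsFrame v) : LinearIndependent ℝ v := by
  rw [Fintype.linearIndependent_iff]
  intro c hc i
  have : form (∑ j, c j • v j) (normal v i) = c i := by
    simp [form_sum_left, form_smul_left, hv.form_normal hn]
  rw [← this, hc, form_zero_left]

/-- A frame, as a basis. -/
def basis (hn : 1 ≤ n) (hv : IsFrame v) : Module.Basis (Fin (n + 1)) ℝ (Fin (n + 1) → ℝ) :=
  basisOfLinearIndependentOfCardEqFinrank (hv.linearIndependent hn) (by simp)

theorem basis_apply (hn : 1 ≤ n) (hv : IsFrame v) (i : Fin (n + 1)) : hv.basis hn i = v i := by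
  simp [basis]

theorem eq_sum (hn : 1 ≤ n) (hv : IsFrame v) (x : Fin (n + 1) → ℝ) :
    x = ∑ i, form x (normal v i) • v i := by
  have h : x = ∑ i, (hv.basis hn).repr x i • v i := by
    conv_lhs => rw [← (hv.basis hn).sum_repr x]
    simp only [basis_apply]
  have h2 : ∀ k, form x (normal v k) = (hv.basis hn).repr x k := fun k => by
    conv_lhs => rw [h]
    simp [form_sum_left, form_smul_left, hv.form_normal hn]
  simp only [h2]
  exact h

theorem eq_zero_of_form_normal (hn : 1 ≤ n) (hv : IsFrame v) {x : Fin (n + 1) → ℝ}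
    (h : ∀ i, form x (normal v i) = 0) : x = 0 := by
  rw [hv.eq_sum hn x]
  simp [h]

theorem eq_zero_of_form (hn : 1 ≤ n) (hv : IsFrame v) {x : Fin (n + 1) → ℝ}
    (h : ∀ i, form x (v i) = 0) : x = 0 := by
  refine hv.eq_zero_of_form_normal hn fun i => ?_
  simp [normal, form_sub_right, form_smul_right, form_sum_right, h]

theorem isom_ext (hn : 1 ≤ n) (hv : IsFrame v) {g h : Isom n}
    (H : ∀ i, Hyperbolic.lin n g (v i) = Hyperbolic.lin n h (v i)) : g = h :=
  lin_injective ((hv.basis hn).ext fun i => by rw [basis_apply, H])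

/-- Equality of the Gram matrices makes the linear map v ↦ w preserve the form, and it sends a
future vector to a future vector. -/
theorem exists_isom (hn : 1 ≤ n) (hv : IsFrame v) (hw : IsFrame w) :
    ∃ g : Isom n, ∀ i, Hyperbolic.lin n g (v i) = w i := by
  set L : Module.End ℝ (Fin (n + 1) → ℝ) := (hv.basis hn).constr ℝ w with hL
  have hLv : ∀ i, L (v i) = w i := fun i => by
    rw [hL, ← hv.basis_apply hn, Module.Basis.constr_basis]
  have hform : ∀ x y, form (L x) (L y) = form x y := fun x y => by
    rw [hv.eq_sum hn x, hv.eq_sum hn y]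
    simp only [map_sum, map_smul, hLv, form_sum_left, form_sum_right, form_smul_left,
      form_smul_right, hv.form_eq, hw.form_eq]
  obtain ⟨g, hg⟩ := exists_isom_of_linear L hform (hv.self 0).le (hv.pos 0)
    (by rw [hLv]; exact hw.pos 0)
  exact ⟨g, fun i => by rw [hg, hLv]⟩

/-- Frames that agree up to scaling at three places agree there. -/
theorem scale_eq_one (hv : IsFrame v) (hw : IsFrame w) {c : Fin (n + 1) → ℝ} {i j k : Fin (n + 1)}
    (hij : i ≠ j) (hik : i ≠ k) (hjk : j ≠ k) (hi : w i = c i • v i) (hj : w j = c j • v j)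
    (hk : w k = c k • v k) : c i = 1 := by
  have e1 := hw.cross i j hij
  have e2 := hw.cross i k hik
  have e3 := hw.cross j k hjk
  rw [hi, hj, form_smul_left, form_smul_right, hv.cross i j hij] at e1
  rw [hi, hk, form_smul_left, form_smul_right, hv.cross i k hik] at e2
  rw [hj, hk, form_smul_left, form_smul_right, hv.cross j k hjk] at e3
  have hp : 0 < c i := by
    have h1 := hw.pos i
    rw [hi, Pi.smul_apply, smul_eq_mul] at h1
    exact pos_of_mul_pos_left h1 (hv.pos i).le
  have h2 : c i * c j = 1 := by linarith
  have h3 : c i * c k = 1 := by linarith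
  have h4 : c j * c k = 1 := by linarith
  have h5 : c i ^ 2 = 1 := by
    calc c i ^ 2 = c i ^ 2 * (c j * c k) := by rw [h4, mul_one]
      _ = (c i * c j) * (c i * c k) := by ring
      _ = 1 := by rw [h2, h3, mul_one]
  exact (pow_eq_one_iff_of_nonneg hp.le two_ne_zero).1 h5

theorem lin_refl_normal_of_ne (hn : 2 ≤ n) (hv : IsFrame v) {i k : Fin (n + 1)} (h : k ≠ i) :
    Hyperbolic.lin n (refl (hv.normal_pos hn i)) (v k) = v k := by
  rw [lin_refl, hv.form_normal (by omega), if_neg h]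
  simp

theorem lin_refl_normal_self (hn : 2 ≤ n) (hv : IsFrame v) (i : Fin (n + 1)) :
    Hyperbolic.lin n (refl (hv.normal_pos hn i)) (v i)
      = v i - (2 / (1 - 1 / n : ℝ)) • normal v i := by
  rw [lin_refl, hv.form_normal (by omega), hv.form_normal_normal (by omega), if_pos rfl,
    mul_one]

/-- Two frames that agree at all places but one are equal or related by a reflection. -/
theorem eq_or_eq_refl (hn : 2 ≤ n) (hv : IsFrame v) (hw : IsFrame w) (i : Fin (n + 1))
    (h : ∀ k, k ≠ i → w k = v k) :
    w i = v i ∨ w i = Hyperbolic.lin n (refl (hv.normal_pos hn i)) (v i) := by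
  have hn1 : 1 ≤ n := by omega
  set e := normal v i with he
  -- The difference w i - v i is orthogonal to every other frame vector, hence a multiple of e; t is
  -- the only possible coefficient.
  set t := form (w i - v i) e / form e e with ht
  have hee : form e e ≠ 0 := (hv.normal_pos hn i).ne'
  have hz : w i - v i - t • e = 0 := by
    set z := w i - v i - t • e with hz
    have hzk : ∀ k, k ≠ i → form z (v k) = 0 := fun k hk => by
      rw [hz, form_sub_left, form_sub_left, form_smul_left, form_comm e, he, hv.form_normal hn1,
        if_neg hk, ← h k hk, hw.cross _ _ hk.symm, h k hk, hv.cross _ _ hk.symm]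
      ring
    have hze : form z e = 0 := by
      rw [hz, form_sub_left, form_smul_left, ht, div_mul_cancel₀ _ hee, sub_self]
    refine hv.eq_zero_of_form hn1 fun k => ?_
    by_cases hk : k = i
    · subst hk
      have h1 : form z e = form z (v k) - 1 / n * form z (v k) := by
        rw [he, normal, form_sub_right, form_smul_right, form_sum_right,
          Finset.sum_eq_single k (fun j _ hj => hzk j hj) (by simp)]
      rw [hze] at h1
      have h2 : (1 - 1 / n : ℝ) ≠ 0 := by
        have := hv.normal_pos hn k
        rw [hv.form_normal_normal hn1, if_pos rfl] at this
        exact this.ne'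
      have h3 : form z (v k) * (1 - 1 / n : ℝ) = 0 := by linarith
      exact (mul_eq_zero.1 h3).resolve_right h2
    · exact hzk k hk
  have hwi : w i = v i + t • e := by
    rw [sub_sub, sub_eq_zero] at hz; exact hz
  have h1 := hw.self i
  have hve : form (v i) e = 1 := by rw [he, hv.form_normal hn1, if_pos rfl]
  rw [hwi] at h1
  simp only [form_add_left, form_add_right, form_smul_left, form_smul_right, hv.self,
    form_comm e, hve] at h1
  -- That w i is lightlike is a quadratic equation for t; its roots 0 and -2/⟨e, e⟩ are the identity
  -- and the reflection.
  have h2 : t * (2 + t * form e e) = 0 := by linarith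
  rcases mul_eq_zero.1 h2 with h3 | h3
  · left; rw [hwi, h3, zero_smul, add_zero]
  · right
    rw [hwi, lin_refl, hve, sub_eq_add_neg, ← neg_smul]
    congr 2
    rw [mul_one, ← neg_div, eq_div_iff hee]
    linarith

end IsFrame

/-! ### Regular ideal simplices and their frames. -/

theorem lightVec_zero (b : Boundary n) : lightVec b 0 = 1 := rfl

theorem form_lightVec_lightVec (b c : Boundary n) :
    form (lightVec b) (lightVec c) = -(∑ i, (b.1 i - c.1 i) ^ 2) / 2 := by
  have hb := sum_sq_boundary b
  have hc := sum_sq_boundary c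
  have : ∑ i, (b.1 i - c.1 i) ^ 2 = ∑ i, b.1 i ^ 2 + ∑ i, c.1 i ^ 2 - 2 * ∑ i, b.1 i * c.1 i := by
    rw [Finset.mul_sum, ← Finset.sum_add_distrib, ← Finset.sum_sub_distrib]
    exact Finset.sum_congr rfl fun i _ => by ring
  rw [this, hb, hc]
  simp only [form, lightVec, Fin.cons_zero, Fin.cons_succ]
  ring

theorem form_lightVec_neg {b c : Boundary n} (h : b ≠ c) :
    form (lightVec b) (lightVec c) < 0 := by
  rw [form_lightVec_lightVec]
  have : 0 < ∑ i, (b.1 i - c.1 i) ^ 2 := by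
    obtain ⟨i, hi⟩ : ∃ i, b.1 i ≠ c.1 i := by
      by_contra! hcon
      exact h (Subtype.ext (PiLp.ext hcon))
    exact Finset.sum_pos' (fun i _ => sq_nonneg _)
      ⟨i, Finset.mem_univ _, by have := sub_ne_zero.2 hi; positivity⟩
  linarith

/-- The scaling factor by which an isometry acts on the normalized light vector of a boundary
point. -/
theorem exists_lin_lightVec (g : Isom n) (b : Boundary n) :
    ∃ c : ℝ, 0 < c ∧ lin n g (lightVec b) = c • lightVec (g • b) := by
  have h := isom_time_pos g (form_lightVec b) (by simp [lightVec])
  refine ⟨_, h, ?_⟩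
  rw [lightVec_smul, smul_smul, mul_inv_cancel₀ h.ne', one_smul]
  rfl

theorem eq_of_lightVec_eq_smul {b c : Boundary n} {t : ℝ} (h : lightVec b = t • lightVec c) :
    b = c := by
  have h0 := congrFun h 0
  simp only [lightVec_zero, Pi.smul_apply, smul_eq_mul, mul_one] at h0
  rw [← h0, one_smul] at h
  exact lightVec_injective h

theorem smul_eq_of_lin_eq_smul {g : Isom n} {b c : Boundary n} {t : ℝ}
    (h : lin n g (lightVec b) = t • lightVec c) : g • b = c := by
  obtain ⟨s, hs, hsb⟩ := exists_lin_lightVec g b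
  rw [hsb] at h
  refine eq_of_lightVec_eq_smul (t := s⁻¹ * t) ?_
  rw [mul_smul, ← h, smul_smul, inv_mul_cancel₀ hs.ne', one_smul]

/-- The scaling factor that turns the light vectors of a regular ideal simplex into a frame. -/
def scale (τ : Fin (n + 1) → Boundary n) (i : Fin (n + 1)) : ℝ :=
  √(-form (lightVec (τ (i + 1))) (lightVec (τ (i + 2))) /
    (form (lightVec (τ i)) (lightVec (τ (i + 1))) * form (lightVec (τ i)) (lightVec (τ (i + 2)))))

/-- The frame of a regular ideal simplex. -/
def toFrame (τ : Fin (n + 1) → Boundary n) (i : Fin (n + 1)) : Fin (n + 1) → ℝ :=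
  scale τ i • lightVec (τ i)

theorem orientation_injective {τ : Fin (n + 1) → Boundary n} (h : orientation τ ≠ 0) :
    Function.Injective τ := by
  intro i j hij
  by_contra hne
  refine h (Matrix.det_zero_of_row_eq hne ?_)
  ext k
  simp [hij]

theorem fin_add_one_ne (hn : 3 ≤ n) (i : Fin (n + 1)) :
    i ≠ i + 1 ∧ i ≠ i + 2 ∧ i + 1 ≠ i + 2 := by
  have h1 : (1 : Fin (n + 1)).val = 1 := by
    rw [Fin.val_one', Nat.mod_eq_of_lt]; omega
  have h2 : (2 : Fin (n + 1)).val = 2 := by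
    change 2 % (n + 1) = 2
    rw [Nat.mod_eq_of_lt]; omega
  have h01 : (1 : Fin (n + 1)) ≠ 0 := fun h => by
    have := congrArg Fin.val h; simp at this; omega
  have h02 : (2 : Fin (n + 1)) ≠ 0 := fun h => by
    have := congrArg Fin.val h; rw [h2] at this; simp at this
  have h12 : (1 : Fin (n + 1)) ≠ 2 := fun h => by
    have := congrArg Fin.val h; omega
  refine ⟨fun h => h01 ?_, fun h => h02 ?_, fun h => h12 (add_left_cancel h)⟩
  · exact left_eq_add.1 h
  · exact left_eq_add.1 h

/-- Cross ratios of a regular ideal simplex are equal to one. -/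
theorem RegularIdeal.cross_ratio {τ : Fin (n + 1) → Boundary n} (hτ : τ ∈ RegularIdeal n)
    {i j k l : Fin (n + 1)} (hij : i ≠ j) (hik : i ≠ k) (hjl : j ≠ l) (hkl : k ≠ l) :
    form (lightVec (τ i)) (lightVec (τ j)) * form (lightVec (τ k)) (lightVec (τ l)) =
      form (lightVec (τ i)) (lightVec (τ k)) * form (lightVec (τ j)) (lightVec (τ l)) := by
  by_cases hjk : j = k
  · subst hjk; rfl
  by_cases hil : i = l
  · subst hil
    rw [form_comm (lightVec (τ k)), form_comm (lightVec (τ j)), mul_comm]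
  have hinj := orientation_injective hτ.1
  obtain ⟨g, hg⟩ := hτ.2 (Equiv.swap j k)
  have hlin : ∀ m, ∃ c : ℝ, 0 < c ∧
      lin n g (lightVec (τ m)) = c • lightVec (τ (Equiv.swap j k m)) := fun m => by
    rw [← hg]; exact exists_lin_lightVec g _
  choose c hc hcg using hlin
  have key : ∀ a b, form (lightVec (τ a)) (lightVec (τ b)) = c a * c b *
      form (lightVec (τ (Equiv.swap j k a))) (lightVec (τ (Equiv.swap j k b))) := fun a b => by
    rw [← form_lin g, hcg, hcg, form_smul_left, form_smul_right, mul_assoc]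
  have hi : Equiv.swap j k i = i := Equiv.swap_apply_of_ne_of_ne hij hik
  have hl : Equiv.swap j k l = l := Equiv.swap_apply_of_ne_of_ne hjl.symm hkl.symm
  have e1 := key i j
  have e2 := key k l
  have e3 := key i k
  have e4 := key j l
  rw [hi, Equiv.swap_apply_left] at e1
  rw [hl, Equiv.swap_apply_right] at e2
  rw [hi, Equiv.swap_apply_right] at e3
  rw [hl, Equiv.swap_apply_left] at e4
  have p1 := form_lightVec_neg (hinj.ne hij)
  have p2 := form_lightVec_neg (hinj.ne hkl)
  have p3 := form_lightVec_neg (hinj.ne hik)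
  have p4 := form_lightVec_neg (hinj.ne hjl)
  have hA := mul_pos_of_neg_of_neg p1 p2
  have hB := mul_pos_of_neg_of_neg p3 p4
  -- The cross ratio A / B is invariant under g, while the swap of j and k inverts it. As A and B
  -- are positive, they are equal.
  set A := form (lightVec (τ i)) (lightVec (τ j)) * form (lightVec (τ k)) (lightVec (τ l))
  set B := form (lightVec (τ i)) (lightVec (τ k)) * form (lightVec (τ j)) (lightVec (τ l))
  set m := c i * c j * c k * c l
  have f1 : A = m * B := by
    calc A = (c i * c j * form (lightVec (τ i)) (lightVec (τ k))) *
          (c k * c l * form (lightVec (τ j)) (lightVec (τ l))) := by rw [← e1, ← e2]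
      _ = m * B := by ring
  have f2 : B = m * A := by
    calc B = (c i * c k * form (lightVec (τ i)) (lightVec (τ j))) *
          (c j * c l * form (lightVec (τ k)) (lightVec (τ l))) := by rw [← e3, ← e4]
      _ = m * A := by ring
  have f3 : A ^ 2 = B ^ 2 := by
    calc A ^ 2 = A * (m * B) := by rw [← f1, sq]
      _ = B * (m * A) := by ring
      _ = B ^ 2 := by rw [← f2, sq]
  exact (pow_left_inj₀ hA.le hB.le two_ne_zero).1 f3

/-- The value is forced by requiring product -1 for the three pairs among i, j, k. Equality of cross
ratios makes it independent of j and k, so the choice of i + 1 and i + 2 in `scale` is immaterial.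
-/
theorem RegularIdeal.scale_sq (hn : 3 ≤ n) {τ : Fin (n + 1) → Boundary n}
    (hτ : τ ∈ RegularIdeal n) {i j k : Fin (n + 1)} (hij : i ≠ j) (hik : i ≠ k) (hjk : j ≠ k) :
    0 < scale τ i ∧ scale τ i ^ 2 = -form (lightVec (τ j)) (lightVec (τ k)) /
      (form (lightVec (τ i)) (lightVec (τ j)) * form (lightVec (τ i)) (lightVec (τ k))) := by
  have hinj := orientation_injective hτ.1
  have neg : ∀ {a b}, a ≠ b → form (lightVec (τ a)) (lightVec (τ b)) < 0 := fun h =>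
    form_lightVec_neg (hinj.ne h)
  have pos : ∀ {a b c}, a ≠ b → a ≠ c → b ≠ c → 0 < -form (lightVec (τ b)) (lightVec (τ c)) /
      (form (lightVec (τ a)) (lightVec (τ b)) * form (lightVec (τ a)) (lightVec (τ c))) :=
    fun h1 h2 h3 => div_pos (neg_pos.2 (neg h3)) (mul_pos_of_neg_of_neg (neg h1) (neg h2))
  have symm : ∀ {a b c}, -form (lightVec (τ b)) (lightVec (τ c)) /
      (form (lightVec (τ a)) (lightVec (τ b)) * form (lightVec (τ a)) (lightVec (τ c))) =
      -form (lightVec (τ c)) (lightVec (τ b)) /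
      (form (lightVec (τ a)) (lightVec (τ c)) * form (lightVec (τ a)) (lightVec (τ b))) := by
    intro a b c
    rw [form_comm (lightVec (τ b)), mul_comm]
  have change : ∀ {a b c d}, a ≠ b → a ≠ c → a ≠ d → b ≠ c → b ≠ d →
      -form (lightVec (τ b)) (lightVec (τ c)) /
      (form (lightVec (τ a)) (lightVec (τ b)) * form (lightVec (τ a)) (lightVec (τ c))) =
      -form (lightVec (τ b)) (lightVec (τ d)) /
      (form (lightVec (τ a)) (lightVec (τ b)) * form (lightVec (τ a)) (lightVec (τ d))) := by
    intro a b c d hab hac had hbc hbd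
    have h1 := (neg hab).ne
    have h2 := (neg hac).ne
    have h3 := (neg had).ne
    have := RegularIdeal.cross_ratio hτ hbc hbd hac.symm had.symm
    rw [form_comm (lightVec (τ d)), form_comm (lightVec (τ c)) (lightVec (τ a))] at this
    rw [div_eq_div_iff (mul_ne_zero h1 h2) (mul_ne_zero h1 h3)]
    linear_combination -(form (lightVec (τ a)) (lightVec (τ b))) * this
  obtain ⟨h1, h2, h12⟩ := fin_add_one_ne hn i
  refine ⟨Real.sqrt_pos.2 (pos h1 h2 h12), ?_⟩
  rw [scale, Real.sq_sqrt (pos h1 h2 h12).le]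
  by_cases hj : j = i + 1
  · subst hj
    exact change h1 h2 hik h12 hjk
  · rw [change h1 h2 hij h12 (Ne.symm hj), symm, change hij h1 hik hj hjk]

theorem RegularIdeal.scale_pos (hn : 3 ≤ n) {τ : Fin (n + 1) → Boundary n}
    (hτ : τ ∈ RegularIdeal n) (i : Fin (n + 1)) : 0 < scale τ i :=
  let ⟨h1, h2, h12⟩ := fin_add_one_ne hn i
  (RegularIdeal.scale_sq hn hτ h1 h2 h12).1

theorem exists_third (hn : 3 ≤ n) (i j : Fin (n + 1)) : ∃ k, i ≠ k ∧ j ≠ k := by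
  have : ({i, j} : Finset (Fin (n + 1))).card < Fintype.card (Fin (n + 1)) := by
    rw [Fintype.card_fin]
    exact (Finset.card_le_two).trans_lt (by omega)
  obtain ⟨k, hk⟩ := Finset.exists_mem_notMem_of_card_lt_card (s := {i, j}) (t := Finset.univ)
    (by rwa [Finset.card_univ])
  simp only [Finset.mem_insert, Finset.mem_singleton, not_or] at hk
  exact ⟨k, Ne.symm hk.2.1, Ne.symm hk.2.2⟩

theorem RegularIdeal.isFrame (hn : 3 ≤ n) {τ : Fin (n + 1) → Boundary n}
    (hτ : τ ∈ RegularIdeal n) : IsFrame (toFrame τ) where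
  self i := by
    rw [toFrame, form_smul_left, form_smul_right, form_lightVec, mul_zero, mul_zero]
  cross i j hij := by
    obtain ⟨k, hik, hjk⟩ := exists_third hn i j
    have hinj := orientation_injective hτ.1
    obtain ⟨p1, s1⟩ := RegularIdeal.scale_sq hn hτ hij hik hjk
    obtain ⟨p2, s2⟩ := RegularIdeal.scale_sq hn hτ hij.symm hjk hik
    have n1 := form_lightVec_neg (hinj.ne hij)
    have n2 := (form_lightVec_neg (hinj.ne hik)).ne
    have n3 := (form_lightVec_neg (hinj.ne hjk)).ne
    rw [toFrame, toFrame, form_smul_left, form_smul_right]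
    rw [form_comm (lightVec (τ j)) (lightVec (τ i))] at s2
    set a := form (lightVec (τ i)) (lightVec (τ j))
    have hsq : (scale τ i * (scale τ j * -a)) ^ 2 = 1 := by
      have h3 := n1.ne
      calc (scale τ i * (scale τ j * -a)) ^ 2 = scale τ i ^ 2 * scale τ j ^ 2 * a ^ 2 := by ring
        _ = 1 := by
          rw [s1, s2]
          field_simp
    have := (pow_eq_one_iff_of_nonneg
      (mul_pos p1 (mul_pos p2 (neg_pos.2 n1))).le two_ne_zero).1 hsq
    linarith
  pos i := by
    simpa [toFrame, lightVec_zero] using RegularIdeal.scale_pos hn hτ i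

theorem exists_lin_toFrame (hn : 3 ≤ n) {τ τ' : Fin (n + 1) → Boundary n}
    (hτ : τ ∈ RegularIdeal n) (g : Isom n) {i j : Fin (n + 1)}
    (h : g • τ i = τ' j) :
    ∃ c : ℝ, toFrame τ' j = c • lin n g (toFrame τ i) := by
  obtain ⟨c, hc, hcg⟩ := exists_lin_lightVec g (τ i)
  refine ⟨scale τ' j / (scale τ i * c), ?_⟩
  have := (RegularIdeal.scale_pos hn hτ i).ne'
  rw [toFrame, toFrame, map_smul, hcg, h, smul_smul, smul_smul]
  congr 1
  field_simp

/-- An isometry that maps a regular ideal simplex to a regular ideal simplex maps its frame to the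
frame of the image. -/
theorem lin_toFrame (hn : 3 ≤ n) {τ τ' : Fin (n + 1) → Boundary n}
    (hτ : τ ∈ RegularIdeal n) (hτ' : τ' ∈ RegularIdeal n) (g : Isom n)
    (h : ∀ i, g • τ i = τ' i) (i : Fin (n + 1)) : lin n g (toFrame τ i) = toFrame τ' i := by
  choose c hc using fun i => exists_lin_toFrame hn hτ g (h i)
  obtain ⟨h1, h2, h12⟩ := fin_add_one_ne hn i
  have := IsFrame.scale_eq_one ((RegularIdeal.isFrame hn hτ).lin g) (RegularIdeal.isFrame hn hτ')
    h1 h2 h12 (hc _) (hc _) (hc _)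
  rw [hc i, this, one_smul]

theorem smul_eq_of_lin_toFrame (hn : 3 ≤ n) {τ τ' : Fin (n + 1) → Boundary n}
    (hτ : τ ∈ RegularIdeal n) {g : Isom n} {i j : Fin (n + 1)} {t : ℝ}
    (h : lin n g (toFrame τ i) = t • toFrame τ' j) : g • τ i = τ' j := by
  have hs := RegularIdeal.scale_pos hn hτ i
  refine smul_eq_of_lin_eq_smul (t := (scale τ i)⁻¹ * t * scale τ' j) ?_
  rw [toFrame, toFrame, map_smul, smul_smul] at h
  rw [mul_assoc, mul_smul, ← h, smul_smul, inv_mul_cancel₀ hs.ne', one_smul]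

/-- The isometry group acts transitively on regular ideal simplices. -/
theorem RegularIdeal.exists_isom (hn : 3 ≤ n) {τ τ' : Fin (n + 1) → Boundary n}
    (hτ : τ ∈ RegularIdeal n) (hτ' : τ' ∈ RegularIdeal n) : ∃ g : Isom n, ∀ i, g • τ i = τ' i := by
  obtain ⟨g, hg⟩ := IsFrame.exists_isom (by omega) (RegularIdeal.isFrame hn hτ)
    (RegularIdeal.isFrame hn hτ')
  exact ⟨g, fun i => smul_eq_of_lin_toFrame hn hτ (t := 1) (by rw [hg, one_smul])⟩

theorem orientation_smul (g : Isom n) (τ : Fin (n + 1) → Boundary n) :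
    ∃ c : ℝ, 0 < c ∧ orientation (fun i => g • τ i) = c * (g.1.1.det * orientation τ) := by
  choose c hc hcg using fun i => exists_lin_lightVec g (τ i)
  refine ⟨∏ i, (c i)⁻¹, Finset.prod_pos fun i _ => inv_pos.2 (hc i), ?_⟩
  have h : (Matrix.of fun i => lightVec (g • τ i)) =
      Matrix.of fun i j => (c i)⁻¹ * ((Matrix.of fun i => lightVec (τ i)) * g.1.1ᵀ) i j := by
    ext i j
    have : lightVec (g • τ i) = (c i)⁻¹ • lin n g (lightVec (τ i)) := by
      rw [hcg, smul_smul, inv_mul_cancel₀ (hc i).ne', one_smul]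
    simp only [Matrix.of_apply, this, Pi.smul_apply, smul_eq_mul, lin_apply]
    congr 1
    simp only [Matrix.mulVec, dotProduct, Matrix.mul_apply, Matrix.transpose_apply, Matrix.of_apply]
    exact Finset.sum_congr rfl fun k _ => mul_comm _ _
  rw [orientation, h, Matrix.det_mul_column, Matrix.det_mul, Matrix.det_transpose,
    mul_comm g.1.1.det]
  rfl

theorem RegularIdeal.smul {τ : Fin (n + 1) → Boundary n} (hτ : τ ∈ RegularIdeal n) (g : Isom n) :
    (fun i => g • τ i) ∈ RegularIdeal n := by
  refine ⟨?_, fun π => ?_⟩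
  · obtain ⟨c, hc, h⟩ := orientation_smul g τ
    rw [h]
    exact mul_ne_zero hc.ne' (mul_ne_zero ((Matrix.isUnit_iff_isUnit_det _).1 g.1.isUnit).ne_zero
      hτ.1)
  · obtain ⟨k, hk⟩ := hτ.2 π
    refine ⟨g * k * g⁻¹, fun i => ?_⟩
    rw [← mul_smul, inv_mul_cancel_right, mul_smul, hk]

theorem RegularIdeal.perm {τ : Fin (n + 1) → Boundary n} (hτ : τ ∈ RegularIdeal n)
    (π : Equiv.Perm (Fin (n + 1))) : (fun i => τ (π i)) ∈ RegularIdeal n := by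
  obtain ⟨g, hg⟩ := hτ.2 π
  simpa only [hg] using RegularIdeal.smul hτ g

theorem orientation_perm (τ : Fin (n + 1) → Boundary n) (π : Equiv.Perm (Fin (n + 1))) :
    orientation (fun i => τ (π i)) = (Equiv.Perm.sign π : ℤ) * orientation τ := by
  rw [orientation, orientation, ← Matrix.det_permute]
  rfl

/-- The isometry group acts freely on regular ideal simplices. -/
theorem RegularIdeal.isom_ext (hn : 3 ≤ n) {τ : Fin (n + 1) → Boundary n}
    (hτ : τ ∈ RegularIdeal n) {g h : Isom n} (H : ∀ i, g • τ i = h • τ i) : g = h := by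
  refine (RegularIdeal.isFrame hn hτ).isom_ext (by omega) fun i => ?_
  rw [lin_toFrame hn hτ (RegularIdeal.smul hτ h) g H,
    lin_toFrame hn hτ (RegularIdeal.smul hτ h) h fun _ => rfl]

/-- Two distinct regular ideal simplices that differ only at one vertex are related by the
reflection in the opposite face. -/
theorem RegularIdeal.eq_or_eq_refl (hn : 3 ≤ n) {τ τ' : Fin (n + 1) → Boundary n}
    (hτ : τ ∈ RegularIdeal n) (hτ' : τ' ∈ RegularIdeal n) (i : Fin (n + 1))
    (h : ∀ k, k ≠ i → τ' k = τ k) :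
    τ' i = τ i ∨
      τ' i = refl ((RegularIdeal.isFrame hn hτ).normal_pos (by omega) i) • τ i := by
  have hv := RegularIdeal.isFrame hn hτ
  have hw := RegularIdeal.isFrame hn hτ'
  have hc : ∀ k, k ≠ i → ∃ c : ℝ, toFrame τ' k = c • toFrame τ k := fun k hk => by
    simpa [lin_one_apply] using exists_lin_toFrame hn hτ 1 (i := k) (j := k)
      (by rw [one_smul, h k hk])
  have hc' : ∃ c : Fin (n + 1) → ℝ, ∀ k, k ≠ i → toFrame τ' k = c k • toFrame τ k :=
    ⟨fun k => if hk : k ≠ i then (hc k hk).choose else 0, fun k hk => by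
      simp only [dif_pos hk]; exact (hc k hk).choose_spec⟩
  obtain ⟨c, hc⟩ := hc'
  have hone : ∀ k, k ≠ i → toFrame τ' k = toFrame τ k := fun k hk => by
    -- `scale_eq_one` compares three common vertices, so two more are chosen away from i and k; this
    -- uses n + 1 ≥ 4.
    have : ({i, k} : Finset (Fin (n + 1))).card ≤ 2 := Finset.card_le_two
    have hcard : 1 < ({i, k} : Finset (Fin (n + 1)))ᶜ.card := by
      rw [Finset.card_compl, Fintype.card_fin]; omega
    obtain ⟨a, ha, b, hb, hab⟩ := Finset.one_lt_card.1 hcard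
    simp only [Finset.mem_compl, Finset.mem_insert, Finset.mem_singleton, not_or] at ha hb
    have := hv.scale_eq_one hw (Ne.symm ha.2) (Ne.symm hb.2) hab (hc k hk) (hc a ha.1) (hc b hb.1)
    rw [hc k hk, this, one_smul]
  rcases hv.eq_or_eq_refl (by omega) hw i hone with h1 | h1
  · left
    have := smul_eq_of_lin_toFrame hn hτ' (g := 1) (i := i) (j := i) (t := 1) (τ' := τ)
      (by rw [lin_one_apply, h1, one_smul])
    rwa [one_smul] at this
  · right
    exact (smul_eq_of_lin_toFrame hn hτ (t := 1) (by rw [← h1, one_smul])).symm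

/-! ### Groups with open orbits on spacelike rays. -/

-- The map (x, s) ↦ (s‖x‖, x) carries (ℝⁿ ∖ {0}) × (-1, 1) onto the spacelike vectors, and ℝⁿ ∖ {0}
-- is connected for n ≥ 2.
open Topology in
theorem isPreconnected_spacelike (hn : 2 ≤ n) :
    IsPreconnected {u : Fin (n + 1) → ℝ | 0 < form u u} := by
  let f : EuclideanSpace ℝ (Fin n) × ℝ → Fin (n + 1) → ℝ := fun p => Fin.cons (‖p.1‖ * p.2) p.1.ofLp
  have hf : Continuous f := by
    refine continuous_pi fun i => ?_
    refine Fin.cases ?_ (fun k => ?_) i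
    · simp only [f, Fin.cons_zero]; fun_prop
    · simp only [f, Fin.cons_succ]; fun_prop
  have hform : ∀ p, form (f p) (f p) = ‖p.1‖ ^ 2 * (1 - p.2 ^ 2) := fun p => by
    rw [form_self, mul_sub, mul_one, EuclideanSpace.real_norm_sq_eq]
    simp only [f, Fin.cons_zero, Fin.cons_succ, mul_pow, EuclideanSpace.real_norm_sq_eq]
    ring
  have hc : IsPreconnected (({0}ᶜ : Set (EuclideanSpace ℝ (Fin n))) ×ˢ Set.Ioo (-1 : ℝ) 1) := by
    refine IsPreconnected.prod ?_ isPreconnected_Ioo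
    refine (isPathConnected_compl_singleton_of_one_lt_rank ?_ 0).isConnected.isPreconnected
    rw [← Module.finrank_eq_rank, finrank_euclideanSpace_fin]
    exact_mod_cast hn
  convert hc.image f hf.continuousOn using 1
  ext u
  constructor
  · intro hu
    have hu' : 0 < form u u := hu
    rw [form_self] at hu'
    set x : EuclideanSpace ℝ (Fin n) := WithLp.toLp 2 fun i => u i.succ with hx
    have hx2 : ‖x‖ ^ 2 = ∑ i : Fin n, u i.succ ^ 2 := by
      rw [EuclideanSpace.real_norm_sq_eq]
    have hlt : u 0 ^ 2 < ‖x‖ ^ 2 := by rw [hx2]; linarith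
    have habs : |u 0| < ‖x‖ := by
      have := sq_lt_sq.1 hlt
      rwa [abs_of_nonneg (norm_nonneg x)] at this
    have hpos : 0 < ‖x‖ := (abs_nonneg _).trans_lt habs
    refine ⟨(x, u 0 / ‖x‖), ⟨by simpa using hpos.ne', ?_⟩, ?_⟩
    · rw [abs_lt] at habs
      constructor
      · rw [lt_div_iff₀ hpos]; linarith
      · rw [div_lt_one hpos]; exact habs.2
    · ext i
      refine Fin.cases ?_ (fun k => ?_) i
      · simp only [f, Fin.cons_zero]; field_simp
      · simp only [f, Fin.cons_succ, hx]
  · rintro ⟨p, ⟨hp1, hp2⟩, rfl⟩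
    change 0 < form _ _
    rw [hform]
    have : 0 < ‖p.1‖ := norm_pos_iff.2 hp1
    have h2 : 0 < 1 - p.2 ^ 2 := by
      have h3 := mul_pos (sub_pos.2 hp2.2) (show 0 < 1 + p.2 by linarith [hp2.1])
      linarith [show (1 - p.2) * (1 + p.2) = 1 - p.2 ^ 2 by ring]
    positivity

/-- The cone over the orbit of `u` under the group `K`. -/
def orbitCone (K : Subgroup (Isom n)) (u : Fin (n + 1) → ℝ) : Set (Fin (n + 1) → ℝ) :=
  {w | ∃ c : ℝ, 0 < c ∧ ∃ k ∈ K, w = c • lin n k u}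

theorem mem_orbitCone_self (K : Subgroup (Isom n)) (u : Fin (n + 1) → ℝ) : u ∈ orbitCone K u :=
  ⟨1, one_pos, 1, K.one_mem, by rw [lin_one_apply, one_smul]⟩

theorem orbitCone_trans {K : Subgroup (Isom n)} {u v w : Fin (n + 1) → ℝ}
    (h : v ∈ orbitCone K u) (h' : w ∈ orbitCone K v) : w ∈ orbitCone K u := by
  obtain ⟨c, hc, k, hk, rfl⟩ := h
  obtain ⟨c', hc', k', hk', rfl⟩ := h'
  exact ⟨c' * c, mul_pos hc' hc, k' * k, K.mul_mem hk' hk, by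
    rw [map_smul, lin_mul_apply, smul_smul]⟩

theorem orbitCone_symm {K : Subgroup (Isom n)} {u v : Fin (n + 1) → ℝ}
    (h : v ∈ orbitCone K u) : u ∈ orbitCone K v := by
  obtain ⟨c, hc, k, hk, rfl⟩ := h
  exact ⟨c⁻¹, inv_pos.2 hc, k⁻¹, K.inv_mem hk, by
    rw [map_smul, lin_inv_apply_self, smul_smul, inv_mul_cancel₀ hc.ne', one_smul]⟩

theorem spacelike_of_mem_orbitCone {K : Subgroup (Isom n)} {u v : Fin (n + 1) → ℝ}
    (hu : 0 < form u u) (h : v ∈ orbitCone K u) : 0 < form v v := by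
  obtain ⟨c, hc, k, hk, rfl⟩ := h
  rw [form_smul_left, form_smul_right, form_lin]
  positivity

open Topology in
/-- A group with open orbit cones is transitive on spacelike rays. -/
theorem mem_orbitCone_of_forall_mem_nhds (hn : 2 ≤ n) {K : Subgroup (Isom n)}
    (hK : ∀ u, 0 < form u u → orbitCone K u ∈ 𝓝 u) {u w : Fin (n + 1) → ℝ} (hu : 0 < form u u)
    (hw : 0 < form w w) : w ∈ orbitCone K u := by
  have hopen : ∀ u, 0 < form u u → IsOpen (orbitCone K u) := fun u hu =>
    isOpen_iff_mem_nhds.2 fun v hv => Filter.mem_of_superset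
      (hK v (spacelike_of_mem_orbitCone hu hv)) fun _ hx => orbitCone_trans hv hx
  let V : Set (Fin (n + 1) → ℝ) := ⋃ v ∈ {v | 0 < form v v ∧ v ∉ orbitCone K u}, orbitCone K v
  have hV : IsOpen V := isOpen_biUnion fun v hv => hopen v hv.1
  -- Orbit cones partition the spacelike vectors, so V is the union of all those other than the one
  -- of u.
  have hdisj : Disjoint (orbitCone K u) V := by
    rw [Set.disjoint_left]
    intro x hx hxV
    obtain ⟨v, hv, hxv⟩ := Set.mem_iUnion₂.1 hxV
    exact hv.2 (orbitCone_trans hx (orbitCone_symm hxv))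
  refine (isPreconnected_spacelike hn).subset_left_of_subset_union (hopen u hu) hV hdisj ?_
    ⟨u, hu, mem_orbitCone_self K u⟩ hw
  intro x hx
  by_cases h : x ∈ orbitCone K u
  · exact Or.inl h
  · exact Or.inr (Set.mem_iUnion₂.2 ⟨x, ⟨hx, h⟩, mem_orbitCone_self K x⟩)

theorem exists_form_eq (f : Module.Dual ℝ (Fin (n + 1) → ℝ)) : ∃ z, ∀ x, form z x = f x := by
  refine ⟨Fin.cons (-f (Pi.single 0 1)) fun i => f (Pi.single i.succ 1), fun x => ?_⟩
  conv_rhs => rw [← Finset.univ_sum_single x]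
  have h : ∀ i, f (Pi.single i (x i)) = x i * f (Pi.single i 1) := fun i => by
    rw [← smul_eq_mul, ← map_smul, ← Pi.single_smul, smul_eq_mul, mul_one]
  rw [map_sum, Fin.sum_univ_succ]
  simp only [h, form, Fin.cons_zero, Fin.cons_succ]
  simp only [mul_comm]
  ring

/-- The composition along a list of one-parameter families, applied to `u`. -/
def listOrbit {ι : Type*} (A : ι → ℝ → (Fin (n + 1) → ℝ) →L[ℝ] (Fin (n + 1) → ℝ))
    (u : Fin (n + 1) → ℝ) : List ι → (ι → ℝ) → Fin (n + 1) → ℝ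
  | [], _ => u
  | i :: l, t => A i (t i) (listOrbit A u l t)

theorem listOrbit_zero {ι : Type*} {A : ι → ℝ → (Fin (n + 1) → ℝ) →L[ℝ] (Fin (n + 1) → ℝ)}
    (hA : ∀ i, A i 0 = 1) (u : Fin (n + 1) → ℝ) (l : List ι) : listOrbit A u l 0 = u := by
  induction l with
  | nil => rfl
  | cons i l ih => simp [listOrbit, ih, hA]

/-- Every factor is the identity at parameter 0, so the product rule gives the sum of the velocities
at u, whatever the order of composition. -/
theorem exists_hasStrictFDerivAt_listOrbit {ι : Type*} [Fintype ι]
    {A : ι → ℝ → (Fin (n + 1) → ℝ) →L[ℝ] (Fin (n + 1) → ℝ)}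
    {X : ι → (Fin (n + 1) → ℝ) →L[ℝ] (Fin (n + 1) → ℝ)}
    (hA : ∀ i, A i 0 = 1) (hX : ∀ i, HasStrictDerivAt (A i) (X i) 0)
    (u : Fin (n + 1) → ℝ) (l : List ι) :
    ∃ D : (ι → ℝ) →L[ℝ] (Fin (n + 1) → ℝ), HasStrictFDerivAt (listOrbit A u l) D 0 ∧
      ∀ τ, D τ = (l.map fun i => τ i • X i u).sum := by
  induction l with
  | nil => exact ⟨0, hasStrictFDerivAt_const _ _, fun τ => rfl⟩
  | cons i l ih =>
    obtain ⟨D, hD, hDτ⟩ := ih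
    have h1 : HasStrictFDerivAt (fun t : ι → ℝ => A i (t i)) _ 0 :=
      HasStrictFDerivAt.comp (g := A i) (f := fun t : ι → ℝ => t i) 0 (hX i).hasStrictFDerivAt
        (ContinuousLinearMap.proj (R := ℝ) (φ := fun _ : ι => ℝ) i).hasStrictFDerivAt
    refine ⟨_, h1.clm_apply hD, fun τ => ?_⟩
    simp [hDτ, hA, listOrbit_zero hA, add_comm]

open Topology in
/-- If the velocities of one-parameter families in `K` span, together with `u`, the whole space,
then the orbit cone of `u` is a neighbourhood of `u`. -/
theorem orbitCone_mem_nhds {ι : Type*} [Fintype ι] {K : Subgroup (Isom n)} {ψ : ι → ℝ → Isom n}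
    {A : ι → ℝ → (Fin (n + 1) → ℝ) →L[ℝ] (Fin (n + 1) → ℝ)}
    {X : ι → (Fin (n + 1) → ℝ) →L[ℝ] (Fin (n + 1) → ℝ)}
    (hψ : ∀ i t, ψ i t ∈ K) (hψA : ∀ i t x, lin n (ψ i t) x = A i t x)
    (hA : ∀ i, A i 0 = 1) (hX : ∀ i, HasStrictDerivAt (A i) (X i) 0) (u : Fin (n + 1) → ℝ)
    (hu : ∀ z, form z u = 0 → (∀ i, form z (X i u) = 0) → z = 0) : orbitCone K u ∈ 𝓝 u := by
  classical
  set l : List ι := Finset.univ.toList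
  obtain ⟨D, hD, hDτ⟩ := exists_hasStrictFDerivAt_listOrbit hA hX u l
  have hDτ' : ∀ τ, D τ = ∑ i, τ i • X i u := fun τ => by
    rw [hDτ, Finset.sum_map_toList]
  -- The factor 1 + p.1 supplies the radial direction u in addition to the velocities; as long as it
  -- is positive, Φ stays in the orbit cone.
  let Φ : ℝ × (ι → ℝ) → Fin (n + 1) → ℝ := fun p => (1 + p.1) • listOrbit A u l p.2
  have hΦ : HasStrictFDerivAt Φ _ (0 : ℝ × (ι → ℝ)) :=
    ((hasStrictFDerivAt_fst (𝕜 := ℝ) (p := (0 : ℝ × (ι → ℝ)))).const_add 1).smul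
      (HasStrictFDerivAt.comp (0 : ℝ × (ι → ℝ)) (g := listOrbit A u l) (f := Prod.snd) hD
        hasStrictFDerivAt_snd)
  have hΦ0 : Φ 0 = u := by simp [Φ, listOrbit_zero hA]
  -- If the derivative were not onto, some nonzero functional would vanish on its range. It is the
  -- product with some z, which `hu` forces to be 0.
  have hsurj := hΦ.map_nhds_eq_of_surj (by
    by_contra hne
    obtain ⟨f, hf0, hf⟩ := Submodule.exists_le_ker_of_lt_top _ (lt_top_iff_ne_top.2 hne)
    obtain ⟨z, hz⟩ := exists_form_eq f
    refine hf0 (LinearMap.ext fun x => ?_)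
    have hval : ∀ (s : ℝ) (τ : ι → ℝ), form z (s • u + ∑ i, τ i • X i u) = 0 := fun s τ => by
      rw [hz]
      refine hf ⟨(s, τ), ?_⟩
      simp [hDτ', listOrbit_zero hA, add_comm]
    have hz0 : z = 0 := by
      refine hu z ?_ fun i => ?_
      · simpa using hval 1 0
      · have := hval 0 (Pi.single i 1)
        rwa [zero_smul, zero_add, Finset.sum_eq_single i (fun j _ hj => by
          rw [Pi.single_eq_of_ne hj, zero_smul]) (by simp), Pi.single_eq_same, one_smul] at this
    rw [← hz, hz0, form_zero_left]
    rfl)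
  have hmem : ∀ (l : List ι) (t : ι → ℝ), ∃ k ∈ K, listOrbit A u l t = lin n k u := by
    intro l t
    induction l with
    | nil => exact ⟨1, K.one_mem, (lin_one_apply u).symm⟩
    | cons i l ih =>
      obtain ⟨k, hk, h⟩ := ih
      exact ⟨ψ i (t i) * k, K.mul_mem (hψ _ _) hk, by
        rw [lin_mul_apply, ← h, hψA]; rfl⟩
  rw [hΦ0] at hsurj
  rw [← hsurj, Filter.mem_map]
  have hpos : ∀ᶠ p : ℝ × (ι → ℝ) in 𝓝 0, 0 < 1 + p.1 :=
    (continuous_const.add continuous_fst).continuousAt.eventually (lt_mem_nhds (by simp))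
  filter_upwards [hpos] with p hp
  obtain ⟨k, hk, h⟩ := hmem l p.2
  exact ⟨1 + p.1, hp, k, hk, by simp only [Φ, h]⟩

/-! ### Generation by reflections. -/

/-- A group that contains all reflections contains all isometries. -/
theorem eq_top_of_forall_refl_mem {K : Subgroup (Isom n)}
    (hK : ∀ (e : Fin (n + 1) → ℝ) (he : 0 < form e e), refl he ∈ K) : K = ⊤ := by
  have hpd : ∀ x : Fin (n + 1) → ℝ, form (base n) x = 0 → x ≠ 0 → 0 < form x x := by
    intro x hx hx0
    rw [form_base, neg_eq_zero] at hx
    rw [form_self, hx, zero_pow two_ne_zero, neg_zero, zero_add]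
    obtain ⟨i, hi⟩ := Function.ne_iff.1 hx0
    induction i using Fin.cases with
    | zero => exact absurd hx hi
    | succ k =>
      have hk : x k.succ ≠ 0 := hi
      exact Finset.sum_pos' (fun i _ => sq_nonneg _) ⟨k, Finset.mem_univ _, by positivity⟩
  let d : Fin (n + 1) → Fin (n + 1) → ℝ := fun i => Pi.single i 1
  have hd0 : d 0 = base n := by
    ext i
    refine Fin.cases ?_ (fun k => ?_) i <;> simp [d, base]
  have hdd : ∀ i j, i ≠ j → form (d i) (d j) = 0 := by
    intro i j hij
    induction i using Fin.cases with
    | zero => rw [hd0, form_base]; simp [d, hij]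
    | succ i =>
      induction j using Fin.cases with
      | zero => rw [form_comm, hd0, form_base]; simp [d, hij]
      | succ j =>
        simp only [ne_eq, Fin.succ_inj] at hij
        simpa [form, d, Pi.single_apply] using Ne.symm hij
  -- Cartan–Dieudonné induction: m bounds the number of basis vectors that g may still move, and
  -- these come last.
  have step : ∀ m : ℕ, ∀ g : Isom n, (∀ i : Fin (n + 1), i.val + m < n + 1 → lin n g (d i) = d i) →
      g ∈ K := by
    intro m
    induction m with
    | zero =>
      intro g hg
      have : g = 1 := by
        refine lin_injective ((Pi.basisFun ℝ (Fin (n + 1))).ext fun i => ?_)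
        rw [Pi.basisFun_apply, map_one]
        exact hg i (by omega)
      rw [this]; exact K.one_mem
    | succ m ih =>
      intro g hg
      by_cases hm : m < n + 1
      swap
      · exact ih g fun i hi => hg i (by omega)
      let a : Fin (n + 1) := ⟨n - m, by omega⟩
      by_cases hga : lin n g (d a) = d a
      · refine ih g fun i hi => ?_
        by_cases hia : i = a
        · rw [hia, hga]
        · refine hg i ?_
          have : i.val ≠ n - m := fun h => hia (Fin.ext h)
          omega
      -- The reflection exchanging g(d a) and d a exists only if their difference is spacelike. For
      -- a = 0 both are points of hyperbolic space and the reversed Cauchy–Schwarz inequality is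
      -- strict; for a ≠ 0 the difference is orthogonal to the fixed base point, where the form is
      -- positive definite.
      · have hpos : 0 < form (lin n g (d a) - d a) (lin n g (d a) - d a) := by
          by_cases ha0 : a = 0
          · rw [ha0, hd0]
            have h1 := (lin_mem_space g (base_mem n))
            have h2 := one_le_neg_form h1 (base_mem n)
            have hne : lin n g (base n) ≠ base n := by rwa [ha0, hd0] at hga
            have h3 : 1 ≠ -form (lin n g (base n)) (base n) := by
              intro h3
              apply hne
              rw [form_comm, form_base, neg_neg] at h3
              have h4 := h1.1
              rw [form_self, ← h3] at h4
              have h5 : ∑ i : Fin n, lin n g (base n) i.succ ^ 2 = 0 := by linarith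
              rw [Finset.sum_eq_zero_iff_of_nonneg fun i _ => sq_nonneg _] at h5
              ext i
              refine Fin.cases ?_ (fun k => ?_) i
              · rw [← h3]; simp [base]
              · have := h5 k (Finset.mem_univ _)
                rw [pow_eq_zero_iff two_ne_zero] at this
                rw [this]; simp [base]
            have h4 := lt_of_le_of_ne h2 h3
            simp only [form_sub_left, form_sub_right, h1.1, (base_mem n).1, form_comm (base n)]
            linarith
          · refine hpd _ ?_ (sub_ne_zero.2 hga)
            have h0 : lin n g (base n) = base n := by
              rw [← hd0]
              refine hg 0 ?_
              have : (a : ℕ) ≠ 0 := fun h => ha0 (Fin.ext h)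
              simp only [a] at this
              simp only [Fin.val_zero]
              omega
            rw [form_sub_right, sub_eq_zero]
            conv_lhs => rw [← h0, form_lin]
        have hmem := hK _ hpos
        have : refl hpos * g ∈ K := by
          refine ih _ fun i hi => ?_
          rw [lin_mul_apply]
          by_cases hia : i = a
          · rw [hia]
            exact lin_refl_sub (form_lin g _ _) hpos
          · have hgi : lin n g (d i) = d i := by
              refine hg i ?_
              have : i.val ≠ n - m := fun h => hia (Fin.ext h)
              omega
            have h0 : form (d i) (lin n g (d a) - d a) = 0 := by
              rw [form_sub_right, hdd i a hia, sub_zero, ← hgi, form_lin, hdd i a hia]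
            rw [hgi, lin_refl, h0]
            simp
        exact (K.mul_mem_cancel_left hmem).1 this
  rw [eq_top_iff]
  intro g _
  exact step (n + 1) g fun i hi => by omega

-- Transitivity on spacelike rays conjugates the single reflection `refl he` into the reflection in
-- any other hyperplane.
open Topology in
theorem eq_top_of_orbitCone_mem_nhds (hn : 2 ≤ n) {K : Subgroup (Isom n)}
    (hK : ∀ u, 0 < form u u → orbitCone K u ∈ 𝓝 u) {e : Fin (n + 1) → ℝ} (he : 0 < form e e)
    (heK : refl he ∈ K) : K = ⊤ := by
  refine eq_top_of_forall_refl_mem fun u hu => ?_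
  obtain ⟨c, hc, k, hk, rfl⟩ := mem_orbitCone_of_forall_mem_nhds hn hK he hu
  have hk' : 0 < form (lin n k e) (lin n k e) := by rwa [form_lin]
  rw [refl_smul hc.ne' hk', ← conj_refl k he hk']
  exact K.mul_mem (K.mul_mem hk heK) (K.inv_mem hk)

/-! ### One-parameter groups, rotations, and density in dimension greater than three. -/

theorem continuous_of_continuous_lin {X : Type*} [TopologicalSpace X] {ψ : X → Isom n}
    (h : ∀ v, Continuous fun x => lin n (ψ x) v) (h' : ∀ v, Continuous fun x => lin n (ψ x)⁻¹ v) :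
    Continuous ψ := by
  have key : ∀ θ : X → Isom n, (∀ v, Continuous fun x => lin n (θ x) v) →
      Continuous fun x => (θ x).1.1 := fun θ hθ => by
    refine continuous_matrix fun i j => ?_
    have := (continuous_apply i).comp (hθ (Pi.single j 1))
    refine this.congr fun x => ?_
    simp [lin_apply]
  exact Continuous.subtype_mk (Units.continuous_iff.2 ⟨key ψ h, key (fun x => (ψ x)⁻¹) h'⟩) _

/-- The parameters at which a one-parameter group of isometries lies in a closed subgroup form a
closed subgroup. -/
theorem exists_addSubgroup_of_oneParameter {K : Subgroup (Isom n)} (hK : IsClosed (K : Set (Isom n)))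
    {ψ : ℝ → Isom n} (hadd : ∀ s t, ψ (s + t) = ψ s * ψ t)
    (hcont : ∀ v, Continuous fun t => lin n (ψ t) v) :
    ∃ T : AddSubgroup ℝ, IsClosed (T : Set ℝ) ∧ ∀ t, t ∈ T ↔ ψ t ∈ K := by
  have h0 : ψ 0 = 1 := by
    have := hadd 0 0
    rwa [add_zero, left_eq_mul] at this
  have hneg : ∀ t, ψ (-t) = (ψ t)⁻¹ := fun t => by
    rw [eq_inv_iff_mul_eq_one, ← hadd, neg_add_cancel, h0]
  have hc : Continuous ψ := continuous_of_continuous_lin hcont fun v => by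
    simp only [← hneg]
    exact (hcont v).comp continuous_neg
  exact ⟨{ carrier := {t | ψ t ∈ K}
           zero_mem' := by simp [h0, K.one_mem]
           add_mem' := fun {s t} hs ht => by
            simp only [Set.mem_ofPred_eq, hadd] at *
            exact K.mul_mem hs ht
           neg_mem' := fun {t} ht => by
            simp only [Set.mem_ofPred_eq, hneg] at *
            exact K.inv_mem ht }, hK.preimage hc, fun t => Iff.rfl⟩

/-- The form, as a continuous linear functional in its first argument. -/
def formL (y : Fin (n + 1) → ℝ) : (Fin (n + 1) → ℝ) →L[ℝ] ℝ :=
  LinearMap.toContinuousLinearMap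
    { toFun := fun x => form x y
      map_add' := fun x x' => form_add_left x x' y
      map_smul' := fun c x => form_smul_left c x y }

@[simp] theorem formL_apply (x y : Fin (n + 1) → ℝ) : formL y x = form x y := rfl

/-- The rotation by the angle `t` in the plane with orthonormal basis `a`, `b`. -/
def rotation (a b : Fin (n + 1) → ℝ) (t : ℝ) : (Fin (n + 1) → ℝ) →L[ℝ] (Fin (n + 1) → ℝ) :=
  1 + (Real.cos t - 1) • ((formL a).smulRight a + (formL b).smulRight b) +
    Real.sin t • ((formL a).smulRight b - (formL b).smulRight a)

theorem rotation_apply (a b : Fin (n + 1) → ℝ) (t : ℝ) (x : Fin (n + 1) → ℝ) :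
    rotation a b t x = x + (Real.cos t - 1) • (form x a • a + form x b • b) +
      Real.sin t • (form x a • b - form x b • a) := rfl

theorem rotation_zero (a b : Fin (n + 1) → ℝ) : rotation a b 0 = 1 := by
  simp [rotation]

theorem hasStrictDerivAt_rotation (a b : Fin (n + 1) → ℝ) :
    HasStrictDerivAt (rotation a b) ((formL a).smulRight b - (formL b).smulRight a) 0 := by
  set P := (formL a).smulRight a + (formL b).smulRight b
  set J := (formL a).smulRight b - (formL b).smulRight a
  have h1 := HasStrictDerivAt.smul_const ((Real.hasStrictDerivAt_cos 0).sub_const 1) P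
  have h2 := HasStrictDerivAt.smul_const (Real.hasStrictDerivAt_sin 0) J
  have h3 := (h1.const_add 1).add h2
  have h4 : -Real.sin 0 • P + Real.cos 0 • J = J := by simp
  rw [h4] at h3
  exact h3

theorem continuous_rotation_apply (a b x : Fin (n + 1) → ℝ) :
    Continuous fun t => rotation a b t x := by
  simp only [rotation_apply]
  fun_prop

theorem form_unit {a b : Fin (n + 1) → ℝ} (ha : form a a = 1) (hb : form b b = 1)
    (hab : form a b = 0) (t : ℝ) :
    form (Real.cos t • a + Real.sin t • b) (Real.cos t • a + Real.sin t • b) = 1 := by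
  simp only [form_add_left, form_add_right, form_smul_left, form_smul_right, ha, hb, hab,
    form_comm b a]
  linear_combination Real.sin_sq_add_cos_sq t

/-- Mirrors whose normals make the angle t compose to the rotation by 2t. This realizes rotations as
isometries and also identifies products of face reflections. -/
theorem lin_refl_mul_refl {a b : Fin (n + 1) → ℝ} (ha : form a a = 1) (hb : form b b = 1)
    (hab : form a b = 0) (t : ℝ)
    (h : 0 < form (Real.cos t • a + Real.sin t • b) (Real.cos t • a + Real.sin t • b))
    (h' : 0 < form a a) (x : Fin (n + 1) → ℝ) :
    lin n (refl h * refl h') x = rotation a b (2 * t) x := by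
  rw [lin_mul_apply, lin_refl, lin_refl, form_unit ha hb hab, ha, rotation_apply]
  simp only [form_sub_left, form_add_right, form_smul_left, form_smul_right, ha, hab,
    Real.cos_two_mul, Real.sin_two_mul, div_one]
  have hs := Real.sin_sq_add_cos_sq t
  ext i
  simp only [Pi.sub_apply, Pi.add_apply, Pi.smul_apply, smul_eq_mul]
  linear_combination (-2 * form x b * b i) * hs

theorem rotation_add {a b : Fin (n + 1) → ℝ} (ha : form a a = 1) (hb : form b b = 1)
    (hab : form a b = 0) (s t : ℝ) (x : Fin (n + 1) → ℝ) :
    rotation a b (s + t) x = rotation a b s (rotation a b t x) := by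
  simp only [rotation_apply, form_add_left, form_sub_left, form_smul_left, form_sub_left, ha, hb,
    hab, form_comm b a, Real.cos_add, Real.sin_add]
  ext i
  simp only [Pi.sub_apply, Pi.add_apply, Pi.smul_apply, smul_eq_mul]
  ring

/-- The one-parameter group of rotations in the plane with orthonormal basis `a`, `b`. -/
theorem exists_rotation_isom {a b : Fin (n + 1) → ℝ} (ha : form a a = 1) (hb : form b b = 1)
    (hab : form a b = 0) : ∃ ψ : ℝ → Isom n, ∀ t x, lin n (ψ t) x = rotation a b t x :=
  ⟨fun t => refl (e := Real.cos (t / 2) • a + Real.sin (t / 2) • b)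
      (by rw [form_unit ha hb hab]; exact one_pos) * refl (e := a) (by rw [ha]; exact one_pos),
    fun t x => by rw [lin_refl_mul_refl ha hb hab, mul_div_cancel₀ _ two_ne_zero]⟩

/-- A closed subgroup of ℝ is ℝ or cyclic, and in a cyclic one 2π and 2α would be commensurable. -/
theorem addSubgroup_eq_top_of_closed_of_irrational {T : AddSubgroup ℝ} (hT : IsClosed (T : Set ℝ))
    {α : ℝ} (hα : ¬∃ r : ℚ, α = r * Real.pi) (h1 : 2 * Real.pi ∈ T) (h2 : 2 * α ∈ T) : T = ⊤ := by
  rcases AddSubgroup.dense_or_cyclic T with h | ⟨c, hc⟩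
  · rw [← AddSubgroup.coe_eq_univ, ← hT.closure_eq]
    exact h.closure_eq
  · exfalso
    rw [hc, AddSubgroup.mem_closure_singleton] at h1 h2
    obtain ⟨p, hp⟩ := h1
    obtain ⟨q, hq⟩ := h2
    rw [zsmul_eq_mul] at hp hq
    have hp0 : (p : ℝ) ≠ 0 := by
      rintro h
      rw [h, zero_mul] at hp
      linarith [Real.pi_pos]
    refine hα ⟨q / p, ?_⟩
    push_cast
    field_simp
    linear_combination (-p / 2 : ℝ) * hq + (q / 2 : ℝ) * hp

/-- Niven's theorem allows only the rational values 0, ±1/2, ±1, and -1/m lies strictly between -1/2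
and 0. The excluded case m = 2 is the case n = 3 of the simplex. -/
theorem not_rational_angle {m : ℕ} (hm : 3 ≤ m) {α : ℝ} (h : Real.cos α = -1 / m) :
    ¬∃ r : ℚ, α = r * Real.pi := by
  intro hr
  have hm' : (3 : ℝ) ≤ m := by exact_mod_cast hm
  have h1 := niven hr ⟨-1 / m, by rw [h]; push_cast; rfl⟩
  rw [h] at h1
  have h2 : (-1 / m : ℝ) < 0 := div_neg_of_neg_of_pos (by norm_num) (by linarith)
  have h3 : (-1 / 2 : ℝ) < -1 / m := by
    rw [div_lt_div_iff₀ (by norm_num) (by linarith)]; linarith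
  rcases h1 with h1 | h1 | h1 | h1 | h1 <;> rw [h1] at h2 h3 <;> first | (norm_num at h2; done) | norm_num at h3

/-- In dimension greater than three, a closed group that contains the reflections in two faces of a
regular ideal simplex contains a full group of rotations. -/
theorem exists_rotation_mem (hn : 3 < n) {v : Fin (n + 1) → Fin (n + 1) → ℝ} (hv : IsFrame v)
    {K : Subgroup (Isom n)} (hK : IsClosed (K : Set (Isom n)))
    (hrefl : ∀ i, refl (hv.normal_pos (by omega) i) ∈ K) {i k : Fin (n + 1)} (hik : i ≠ k) :
    ∃ (ψ : ℝ → Isom n) (a b : Fin (n + 1) → ℝ) (c : ℝ), c ≠ 0 ∧ (∀ t, ψ t ∈ K) ∧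
      (∀ t x, lin n (ψ t) x = rotation a b t x) ∧
      ∀ x z, form z ((formL a).smulRight b x - (formL b).smulRight a x) =
        c * (form x (IsFrame.normal v i) * form z (IsFrame.normal v k) -
          form x (IsFrame.normal v k) * form z (IsFrame.normal v i)) := by
  have hn1 : 1 ≤ n := by omega
  have hn2 : 2 ≤ n := by omega
  have hN : (3 : ℝ) < n := by exact_mod_cast hn
  set e := IsFrame.normal v i with he
  set f := IsFrame.normal v k with hf
  have hee : form e e = 1 - 1 / n := by rw [hv.form_normal_normal hn1, if_pos rfl]
  have hff : form f f = 1 - 1 / n := by rw [hv.form_normal_normal hn1, if_pos rfl]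
  have hef : form e f = -(1 / n) := by rw [hv.form_normal_normal hn1, if_neg hik, zero_sub]
  set q : ℝ := 1 - 1 / n with hq
  have hqpos : 0 < q := by rw [← hee]; exact hv.normal_pos hn2 i
  set r : ℝ := √q with hr
  have hrpos : 0 < r := Real.sqrt_pos.2 hqpos
  have hr2 : r ^ 2 = q := Real.sq_sqrt hqpos.le
  -- This is the angle between the normals: ⟨e, f⟩/⟨e, e⟩ = -(1/n)/(1 - 1/n) = -1/(n - 1).
  set α := Real.arccos (-1 / ((n - 1 : ℕ) : ℝ)) with hα
  have hcast : ((n - 1 : ℕ) : ℝ) = n - 1 := by rw [Nat.cast_sub hn1, Nat.cast_one]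
  have hcos : Real.cos α = -1 / ((n - 1 : ℕ) : ℝ) := by
    refine Real.cos_arccos ?_ ?_
    · rw [hcast, le_div_iff₀ (by linarith)]; linarith
    · rw [hcast, div_le_one (by linarith)]; linarith
  have hirr := not_rational_angle (m := n - 1) (by omega) hcos
  have hsin : 0 < Real.sin α := by
    rw [hα, Real.sin_arccos]
    refine Real.sqrt_pos.2 ?_
    rw [hcast]
    have h1 : (-1 / ((n : ℝ) - 1)) ^ 2 < 1 := by
      rw [div_pow, div_lt_one (by have : 0 < (n : ℝ) - 1 := by linarith
                                  positivity)]
      nlinarith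
    linarith
  have hcosq : Real.cos α * q = -(1 / n) := by
    rw [hcos, hcast, hq]
    have : (n : ℝ) - 1 ≠ 0 := by linarith
    field_simp
  -- Gram–Schmidt for the normals e and f, both of length r.
  set a := r⁻¹ • e with ha
  set b := (Real.sin α)⁻¹ • (r⁻¹ • f - Real.cos α • a) with hb
  have haa : form a a = 1 := by
    rw [ha, form_smul_left, form_smul_right, hee, ← hr2]; field_simp
  have hfa : form a f = r * Real.cos α := by
    rw [ha, form_smul_left, hef, ← hcosq, ← hr2]; field_simp
  have hab : form a b = 0 := by
    rw [hb, form_smul_right, form_sub_right, form_smul_right, form_smul_right, hfa, haa]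
    field_simp; ring
  have hfu : r⁻¹ • f = Real.cos α • a + Real.sin α • b := by
    rw [hb, smul_smul (Real.sin α), mul_inv_cancel₀ hsin.ne', one_smul]; abel
  have hbb : form b b = 1 := by
    have h1 : form (r⁻¹ • f) (r⁻¹ • f) = 1 := by
      rw [form_smul_left, form_smul_right, hff, ← hr2]; field_simp
    rw [hfu] at h1
    simp only [form_add_left, form_add_right, form_smul_left, form_smul_right, haa, hab,
      form_comm b a] at h1
    have h2 := Real.sin_sq_add_cos_sq α
    have h3 : Real.sin α ^ 2 * (form b b - 1) = 0 := by linear_combination h1 - h2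
    have := (mul_eq_zero.1 h3).resolve_left (by positivity)
    linarith
  obtain ⟨ψ, hψ⟩ := exists_rotation_isom haa hbb hab
  have hadd : ∀ s t, ψ (s + t) = ψ s * ψ t := fun s t => isom_ext fun x => by
    rw [lin_mul_apply, hψ, hψ, hψ, rotation_add haa hbb hab]
  obtain ⟨T, hT, hTK⟩ := exists_addSubgroup_of_oneParameter hK hadd fun x => by
    simp only [hψ]; exact continuous_rotation_apply a b x
  have hTtop : T = ⊤ := by
    refine addSubgroup_eq_top_of_closed_of_irrational hT hirr ?_ ?_
    · rw [hTK]
      have : ψ (2 * Real.pi) = 1 := isom_ext fun x => by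
        rw [hψ, rotation_apply, lin_one_apply]; simp
      rw [this]; exact K.one_mem
    · rw [hTK]
      have hu := form_unit haa hbb hab α
      have hupos : 0 < form (Real.cos α • a + Real.sin α • b) (Real.cos α • a + Real.sin α • b) := by
        rw [hu]; exact one_pos
      have hapos : 0 < form a a := by rw [haa]; exact one_pos
      have : ψ (2 * α) = refl hupos * refl hapos := isom_ext fun x => by
        rw [hψ, lin_refl_mul_refl haa hbb hab]
      rw [this]
      refine K.mul_mem ?_ ?_
      · have h1 := hrefl k
        have h2 : 0 < form (r⁻¹ • f) (r⁻¹ • f) := by rw [hfu]; exact hupos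
        rw [← refl_smul (inv_ne_zero hrpos.ne') _ h2] at h1
        convert h1 using 2
        exact hfu.symm
      · have h1 := hrefl i
        rwa [← refl_smul (inv_ne_zero hrpos.ne') _ hapos] at h1
  -- The constant c is determined by a ∧ b = c · e ∧ f, so that the velocities can be expressed by
  -- the normals alone.
  refine ⟨ψ, a, b, (Real.sin α)⁻¹ * (r⁻¹ * r⁻¹), by positivity, fun t => by
    rw [← hTK, hTtop]; trivial, hψ, fun x z => ?_⟩
  simp only [ContinuousLinearMap.smulRight_apply, formL_apply, form_sub_right, form_smul_right, ha,
    hb]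
  ring

/-- In dimension greater than three, a closed group that contains the reflections in the faces of a
regular ideal simplex contains all isometries. -/
theorem eq_top_of_refl_normal_mem (hn : 3 < n) {v : Fin (n + 1) → Fin (n + 1) → ℝ}
    (hv : IsFrame v) {K : Subgroup (Isom n)} (hK : IsClosed (K : Set (Isom n)))
    (hrefl : ∀ i, refl (hv.normal_pos (by omega) i) ∈ K) : K = ⊤ := by
  have hn1 : 1 ≤ n := by omega
  refine eq_top_of_orbitCone_mem_nhds (by omega) (fun u hu => ?_) _ (hrefl 0)
  choose ψ a b c hc hψK hψ hform using fun p : {p : Fin (n + 1) × Fin (n + 1) // p.1 ≠ p.2} =>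
    exists_rotation_mem hn hv hK hrefl p.2
  refine orbitCone_mem_nhds hψK hψ (fun p => rotation_zero _ _)
    (fun p => hasStrictDerivAt_rotation _ _) u fun z hzu hz => ?_
  -- Orthogonality to all velocities means that the 2 × 2 minors of the coordinates of u and z
  -- vanish. So z is a multiple of u, and ⟨z, u⟩ = 0 with u spacelike leaves only z = 0.
  have hz' : ∀ i k, i ≠ k → form u (IsFrame.normal v i) * form z (IsFrame.normal v k) =
      form u (IsFrame.normal v k) * form z (IsFrame.normal v i) := fun i k hik => by
    have h1 := hz ⟨(i, k), hik⟩
    rw [_root_.sub_apply, hform] at h1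
    exact sub_eq_zero.1 ((mul_eq_zero.1 h1).resolve_left (hc _))
  obtain ⟨k, hk⟩ : ∃ k, form u (IsFrame.normal v k) ≠ 0 := by
    by_contra! hcon
    rw [hv.eq_zero_of_form_normal hn1 hcon, form_zero_left] at hu
    exact lt_irrefl _ hu
  have h1 : z - (form z (IsFrame.normal v k) / form u (IsFrame.normal v k)) • u = 0 := by
    refine hv.eq_zero_of_form_normal hn1 fun i => ?_
    rw [form_sub_left, form_smul_left]
    by_cases hik : i = k
    · rw [hik]; field_simp; ring
    · have := hz' i k hik
      field_simp
      linarith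
  rw [sub_eq_zero] at h1
  rw [h1, form_smul_left] at hzu
  rw [h1, (mul_eq_zero.1 hzu).resolve_right hu.ne', zero_smul]

theorem isFaceReflection_refl (hn : 3 ≤ n) {σ : Fin (n + 1) → Boundary n}
    (hσ : σ ∈ RegularIdeal n) (i : Fin (n + 1)) :
    IsFaceReflection σ i (refl ((RegularIdeal.isFrame hn hσ).normal_pos (by omega) i)) := by
  have hv := RegularIdeal.isFrame hn hσ
  have he := hv.normal_pos (by omega) i
  refine ⟨fun h => ?_, fun x hxs hx => ?_⟩
  · have h1 : lin n (refl he) (IsFrame.normal (toFrame σ) i) = IsFrame.normal (toFrame σ) i := by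
      rw [h, lin_one_apply]
    rw [lin_refl, mul_div_cancel_right₀ _ he.ne'] at h1
    have h2 : IsFrame.normal (toFrame σ) i = 0 := by
      simpa using h1
    rw [h2, form_zero_left] at he
    exact lt_irrefl _ he
  · have h0 : form x (IsFrame.normal (toFrame σ) i) = 0 := by
      clear hxs
      induction hx using Submodule.span_induction with
      | mem y hy =>
        obtain ⟨j, hj, rfl⟩ := hy
        have h1 := hv.form_normal (by omega) i j
        rw [if_neg hj, toFrame, form_smul_left] at h1
        exact (mul_eq_zero.1 h1).resolve_left (RegularIdeal.scale_pos hn hσ j).ne'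
      | zero => exact form_zero_left _
      | add y z _ _ hy hz => rw [form_add_left, hy, hz, add_zero]
      | smul c y _ hy => rw [form_smul_left, hy, mul_zero]
    change lin n _ x = x
    rw [lin_refl, h0]
    simp

theorem dense_reflectionGroup (hn : 3 < n) {σ : Fin (n + 1) → Boundary n}
    (hσ : σ ∈ RegularIdeal n) : Dense (reflectionGroup σ : Set (Isom n)) := by
  have h := eq_top_of_refl_normal_mem hn (RegularIdeal.isFrame hn.le hσ)
    (reflectionGroup σ).isClosed_topologicalClosure fun i =>
      (reflectionGroup σ).le_topologicalClosure
        (Subgroup.subset_closure ⟨i, isFaceReflection_refl hn.le hσ i⟩)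
  rw [dense_iff_closure_eq, ← Subgroup.topologicalClosure_coe, h, Subgroup.coe_top]

/-! ### Parabolic translations, and density in dimension three. -/

/-- The parabolic translation along the light vector `v` in the direction `t • y`. -/
def translation (v y : Fin (n + 1) → ℝ) (t : ℝ) : (Fin (n + 1) → ℝ) →L[ℝ] (Fin (n + 1) → ℝ) :=
  1 + t • ((formL y).smulRight v - (formL v).smulRight y) -
    t ^ 2 • (formL v).smulRight ((form y y / 2) • v)

theorem translation_apply (v y : Fin (n + 1) → ℝ) (t : ℝ) (x : Fin (n + 1) → ℝ) :
    translation v y t x = x + t • (form x y • v - form x v • y) -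
      t ^ 2 • (form x v • (form y y / 2) • v) := rfl

theorem translation_zero (v y : Fin (n + 1) → ℝ) : translation v y 0 = 1 := by
  simp [translation]

theorem hasStrictDerivAt_translation (v y : Fin (n + 1) → ℝ) :
    HasStrictDerivAt (translation v y) ((formL y).smulRight v - (formL v).smulRight y) 0 := by
  set Q := (formL v).smulRight ((form y y / 2) • v)
  set J := (formL y).smulRight v - (formL v).smulRight y
  have h1 := HasStrictDerivAt.smul_const (hasStrictDerivAt_id (0 : ℝ)) J
  have h2 := HasStrictDerivAt.smul_const (hasStrictDerivAt_pow 2 (0 : ℝ)) Q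
  have h3 := (h1.const_add 1).sub h2
  have h4 : (1 : ℝ) • J - (((2 : ℕ) : ℝ) * 0 ^ (2 - 1)) • Q = J := by simp
  rw [h4] at h3
  exact h3

theorem continuous_translation_apply (v y x : Fin (n + 1) → ℝ) :
    Continuous fun t => translation v y t x := by
  simp only [translation_apply]
  fun_prop

theorem translation_add {v y : Fin (n + 1) → ℝ} (hv : form v v = 0) (hvy : form v y = 0) (s t : ℝ)
    (x : Fin (n + 1) → ℝ) :
    translation v y (s + t) x = translation v y s (translation v y t x) := by
  simp only [translation_apply, form_add_left, form_sub_left, form_smul_left, hv, hvy,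
    form_comm y v]
  ext i
  simp only [Pi.sub_apply, Pi.add_apply, Pi.smul_apply, smul_eq_mul]
  ring

/-- The one-parameter group of parabolic translations. -/
theorem exists_translation_isom {v y : Fin (n + 1) → ℝ} (hv : form v v = 0) (hv0 : 0 < v 0)
    (hvy : form v y = 0) : ∃ ψ : ℝ → Isom n, ∀ t x, lin n (ψ t) x = translation v y t x := by
  have h : ∀ t, ∃ g : Isom n, lin n g = (translation v y t).toLinearMap := fun t => by
    refine exists_isom_of_linear _ (fun x z => ?_) hv.le hv0 ?_
    · simp only [ContinuousLinearMap.coe_coe, translation_apply, form_add_left, form_sub_left,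
        form_smul_left, form_add_right, form_sub_right, form_smul_right, hv, hvy,
        form_comm y v, form_comm v z, form_comm y z]
      ring
    · rw [ContinuousLinearMap.coe_coe, translation_apply, hv, hvy]
      simpa using hv0
  choose ψ hψ using h
  exact ⟨ψ, fun t x => by rw [hψ]; rfl⟩

theorem addSubgroup_eq_top_of_closed_of_half_mem {T : AddSubgroup ℝ} (hT : IsClosed (T : Set ℝ))
    {t : ℝ} (ht : t ∈ T) (ht0 : t ≠ 0) (h : ∀ s ∈ T, s / 2 ∈ T) : T = ⊤ := by
  rcases AddSubgroup.dense_or_cyclic T with hd | ⟨c, hc⟩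
  · rw [← AddSubgroup.coe_eq_univ, ← hT.closure_eq]
    exact hd.closure_eq
  · exfalso
    have h1 := h c (by rw [hc]; exact AddSubgroup.mem_closure_singleton_self c)
    rw [hc, AddSubgroup.mem_closure_singleton] at h1 ht
    obtain ⟨m, hm⟩ := h1
    obtain ⟨k, hk⟩ := ht
    rw [zsmul_eq_mul] at hm
    have hc0 : c ≠ 0 := by
      rintro rfl
      exact ht0 (by rw [← hk, smul_zero])
    have h2 : (m : ℝ) * 2 = 1 := by
      field_simp at hm
      linarith
    have h3 : m * 2 = 1 := by exact_mod_cast h2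
    omega

theorem translation_conj (g : Isom n) (v y : Fin (n + 1) → ℝ) (t : ℝ) (x : Fin (n + 1) → ℝ) :
    lin n g (translation v y t (lin n g⁻¹ x)) =
      translation (lin n g v) (lin n g y) t x := by
  have h : ∀ z, form (lin n g⁻¹ x) z = form x (lin n g z) := fun z => by
    rw [form_lin_left, inv_inv]
  simp only [translation_apply, map_add, map_sub, map_smul, lin_apply_inv_self, form_lin, h]

/-- The vertices `2v₀, v₁/2, …` of the image of a three-dimensional regular ideal simplex under the
hyperbolic translation by `log 2` along an edge. -/
def doubled (v : Fin (3 + 1) → Fin (3 + 1) → ℝ) : Fin (3 + 1) → Fin (3 + 1) → ℝ :=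
  ![(2 : ℝ) • v 0, (1 / 2 : ℝ) • v 1, v 0 + v 2 - (1 / 2 : ℝ) • v 1,
    v 0 + v 3 - (1 / 2 : ℝ) • v 1]

theorem sum_univ_three_add_one (v : Fin (3 + 1) → Fin (3 + 1) → ℝ) :
    ∑ j, v j = v 0 + v 1 + v 2 + v 3 := Fin.sum_univ_four v

theorem IsFrame.lin_refl_normal_three {v : Fin (3 + 1) → Fin (3 + 1) → ℝ} (hv : IsFrame v)
    (i : Fin (3 + 1)) : Hyperbolic.lin 3 (refl (hv.normal_pos (by norm_num) i)) (v i) =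
      (∑ j, v j) - (2 : ℝ) • v i := by
  rw [hv.lin_refl_normal_self (by norm_num), normal]
  norm_num
  module

/-- In dimension three, a closed group that contains the face reflections, the symmetries and the
doubling of a regular ideal simplex contains a full group of parabolic translations. -/
theorem exists_translation_mem {v : Fin (3 + 1) → Fin (3 + 1) → ℝ} (hv : IsFrame v)
    {K : Subgroup (Isom 3)} (hK : IsClosed (K : Set (Isom 3)))
    (hrefl : ∀ i, refl (hv.normal_pos (by norm_num) i) ∈ K)
    (hd : ∃ d ∈ K, ∀ i, lin 3 d (v i) = doubled v i) :
    ∃ ψ : ℝ → Isom 3, (∀ t, ψ t ∈ K) ∧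
      ∀ t x, lin 3 (ψ t) x = translation (v 0) (IsFrame.normal v 3) t x := by
  have hn1 : 1 ≤ 3 := by norm_num
  obtain ⟨d, hdK, hdv⟩ := hd
  have hve : form (v 0) (IsFrame.normal v 3) = 0 := by
    rw [hv.form_normal hn1, if_neg (by decide)]
  obtain ⟨ψ, hψ⟩ := exists_translation_isom (hv.self 0) (hv.pos 0) hve
  have hadd : ∀ s t, ψ (s + t) = ψ s * ψ t := fun s t => isom_ext fun x => by
    rw [lin_mul_apply, hψ, hψ, hψ, translation_add (hv.self 0) hve]
  obtain ⟨T, hT, hTK⟩ := exists_addSubgroup_of_oneParameter hK hadd fun x => by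
    simp only [hψ]; exact continuous_translation_apply _ _ x
  have hd0 : lin 3 d (v 0) = (2 : ℝ) • v 0 := hdv 0
  -- The doubling translates along the edge from v 0 to v 1 and fixes the orthogonal complement of
  -- these two vectors, where this normal lies.
  have hd3 : lin 3 d (IsFrame.normal v 3) = IsFrame.normal v 3 := by
    rw [IsFrame.normal, sum_univ_three_add_one]
    simp only [map_sub, map_smul, map_add, hdv, doubled]
    ext i
    simp
    ring
  have hconj : ∀ t, d * ψ t * d⁻¹ = ψ (2 * t) := fun t => isom_ext fun x => by
    rw [lin_mul_apply, lin_mul_apply, hψ, hψ, translation_conj, hd0, hd3]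
    simp only [translation_apply, form_smul_right]
    ext i
    simp only [Pi.sub_apply, Pi.add_apply, Pi.smul_apply, smul_eq_mul]
    ring
  have hhalf : ∀ s ∈ T, s / 2 ∈ T := fun s hs => by
    rw [hTK] at hs ⊢
    have h1 := hconj (s / 2)
    rw [mul_div_cancel₀ _ two_ne_zero] at h1
    have h2 : ψ (s / 2) = d⁻¹ * ψ s * d := by rw [← h1]; group
    rw [h2]
    exact K.mul_mem (K.mul_mem (K.inv_mem hdK) hs) hdK
  -- The reflected normal r(e 2) is, up to sign, e 3 + v 0, so the two mirrors are tangent at the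
  -- ideal point v 0 and their reflections compose to a parabolic translation. Its parameter is 2/⟨e
  -- 3, e 3⟩ = 3.
  have h3 : (3 : ℝ) ∈ T := by
    rw [hTK]
    set r := refl (hv.normal_pos (by norm_num) 1)
    set e := IsFrame.normal v with he
    have hform := hv.form_normal_normal hn1
    have hr2 : lin 3 r (e 2) = -v 0 - e 3 := by
      rw [lin_refl, hform, hform, if_neg (by decide), if_pos rfl]
      simp only [he, IsFrame.normal, sum_univ_three_add_one]
      ext i
      simp
      ring
    have hpos : 0 < form (lin 3 r (e 2)) (lin 3 r (e 2)) := by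
      rw [form_lin]; exact hv.normal_pos (by norm_num) 2
    have hmem : refl hpos ∈ K := by
      rw [← conj_refl r (hv.normal_pos (by norm_num) 2)]
      exact K.mul_mem (K.mul_mem (hrefl 1) (hrefl 2)) (K.inv_mem (hrefl 1))
    have : ψ 3 = refl hpos * refl (hv.normal_pos (by norm_num) 3) := isom_ext fun x => by
      rw [hψ, lin_mul_apply, lin_refl, lin_refl, form_lin, hform, hform, if_pos rfl, if_pos rfl,
        hr2, translation_apply, hform, if_pos rfl]
      have h00 := hv.self 0
      have h33 : form (e 3) (e 3) = 2 / 3 := by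
        rw [he, hform, if_pos rfl]; norm_num
      rw [← he]
      simp only [form_sub_left, form_sub_right, form_smul_left, form_neg_right, form_comm (e 3),
        hve, h33]
      ext i
      simp
      ring
    rw [this]
    exact K.mul_mem hmem (hrefl 3)
  have hTtop := addSubgroup_eq_top_of_closed_of_half_mem hT h3 (by norm_num) hhalf
  exact ⟨ψ, fun t => by rw [← hTK, hTtop]; trivial, hψ⟩

/-- The velocities at u are ⟨u, eₖ⟩vᵢ - ⟨u, vᵢ⟩eₖ with eₖ the normals and i ≠ k; they and u have no
common nonzero orthogonal vector when u is spacelike. -/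
theorem eq_top_of_translation_mem (hn : 2 ≤ n) {v : Fin (n + 1) → Fin (n + 1) → ℝ}
    (hv : IsFrame v) {K : Subgroup (Isom n)} (hrefl : refl (hv.normal_pos hn 0) ∈ K)
    (htrans : ∀ i k, i ≠ k → ∃ ψ : ℝ → Isom n, (∀ t, ψ t ∈ K) ∧
      ∀ t x, lin n (ψ t) x = translation (v i) (IsFrame.normal v k) t x) : K = ⊤ := by
  have hn1 : 1 ≤ n := by omega
  refine eq_top_of_orbitCone_mem_nhds hn (fun u hu => ?_) _ hrefl
  choose ψ hψK hψ using fun p : {p : Fin (n + 1) × Fin (n + 1) // p.1 ≠ p.2} =>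
    htrans p.1.1 p.1.2 p.2
  refine orbitCone_mem_nhds hψK hψ (fun p => translation_zero _ _)
    (fun p => hasStrictDerivAt_translation _ _) u fun z hzu hz => ?_
  have hz' : ∀ i k, i ≠ k → form u (IsFrame.normal v k) * form z (v i) =
      form u (v i) * form z (IsFrame.normal v k) := fun i k hik => by
    have h1 := hz ⟨(i, k), hik⟩
    simp only [_root_.sub_apply, ContinuousLinearMap.smulRight_apply, formL_apply, form_sub_right,
      form_smul_right] at h1
    linarith
  obtain ⟨i, hi⟩ : ∃ i, form u (v i) ≠ 0 := by
    by_contra! hcon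
    rw [hv.eq_zero_of_form hn1 hcon, form_zero_left] at hu
    exact lt_irrefl _ hu
  set c := form z (v i) / form u (v i) with hc
  -- The relations are linear in z and hold for z = u, hence for y too, and c makes y orthogonal to
  -- v i. This leaves y = m • v i, and m ≠ 0 would force u to be a multiple of the lightlike v i.
  set y := z - c • u with hy
  have hyk : ∀ k, k ≠ i → form y (IsFrame.normal v k) = 0 := fun k hk => by
    have h1 := hz' i k hk.symm
    rw [hy, form_sub_left, form_smul_left, hc]
    field_simp
    linarith
  have hyrel : ∀ j k, j ≠ k → form u (IsFrame.normal v k) * form y (v j) =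
      form u (v j) * form y (IsFrame.normal v k) := fun j k hjk => by
    rw [hy, form_sub_left, form_smul_left, form_sub_left, form_smul_left]
    linear_combination hz' j k hjk
  set m := form y (IsFrame.normal v i) with hm
  have hyv : y = m • v i := by
    conv_lhs => rw [hv.eq_sum hn1 y]
    exact Finset.sum_eq_single i (fun k _ hk => by rw [hyk k hk, zero_smul]) (by simp)
  have hm0 : m = 0 := by
    by_contra hm0
    have huk : ∀ k, k ≠ i → form u (IsFrame.normal v k) = 0 := fun k hk => by
      -- A third index is needed because ⟨y, v j⟩ = -m holds only for j ≠ i, and the relation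
      -- between j and k only for j ≠ k.
      obtain ⟨j, hj⟩ : ∃ j, j ∉ ({i, k} : Finset (Fin (n + 1))) := by
        by_contra! hcon
        have := Finset.card_le_card (fun j (_ : j ∈ Finset.univ) => hcon j)
        rw [Finset.card_univ, Fintype.card_fin] at this
        have := this.trans Finset.card_le_two
        omega
      simp only [Finset.mem_insert, Finset.mem_singleton, not_or] at hj
      have h1 := hyrel j k hj.2
      rw [hyk k hk, mul_zero, hyv, form_smul_left, hv.cross i j (Ne.symm hj.1)] at h1
      have h2 : form u (IsFrame.normal v k) * m = 0 := by linarith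
      exact (mul_eq_zero.1 h2).resolve_right hm0
    have h3 : u = form u (IsFrame.normal v i) • v i := by
      conv_lhs => rw [hv.eq_sum hn1 u]
      exact Finset.sum_eq_single i (fun k _ hk => by rw [huk k hk, zero_smul]) (by simp)
    rw [h3, form_smul_left, form_smul_right, hv.self] at hu
    simp at hu
  have h1 : z = c • u := by
    rw [hm0, zero_smul, hy, sub_eq_zero] at hyv
    exact hyv
  rw [h1, form_smul_left] at hzu
  rw [h1, (mul_eq_zero.1 hzu).resolve_right hu.ne', zero_smul]

/-- In dimension three, a closed group that contains the face reflections, the symmetries and the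
doubling of a regular ideal simplex contains all isometries. -/
theorem eq_top_of_doubled_mem {v : Fin (3 + 1) → Fin (3 + 1) → ℝ} (hv : IsFrame v)
    {K : Subgroup (Isom 3)} (hK : IsClosed (K : Set (Isom 3)))
    (hrefl : ∀ i, refl (hv.normal_pos (by norm_num) i) ∈ K)
    (hperm : ∀ π : Equiv.Perm (Fin (3 + 1)), ∃ s ∈ K, ∀ i, lin 3 s (v i) = v (π i))
    (hd : ∃ d ∈ K, ∀ i, lin 3 d (v i) = doubled v i) : K = ⊤ := by
  refine eq_top_of_translation_mem (by norm_num) hv (hrefl 0) fun i k hik => ?_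
  obtain ⟨ψ, hψK, hψ⟩ := exists_translation_mem hv hK hrefl hd
  obtain ⟨π, hπ0, hπ3⟩ : ∃ π : Equiv.Perm (Fin (3 + 1)), π 0 = i ∧ π 3 = k := by
    refine ⟨Equiv.swap 0 i * Equiv.swap 3 (Equiv.swap 0 i k), ?_, ?_⟩
    · have h0 : (0 : Fin (3 + 1)) ≠ Equiv.swap 0 i k := fun h => hik (by
        have := congrArg (Equiv.swap 0 i) h
        rwa [Equiv.swap_apply_self, Equiv.swap_apply_left] at this)
      rw [Equiv.Perm.mul_apply, Equiv.swap_apply_of_ne_of_ne (by decide) h0,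
        Equiv.swap_apply_left]
    · rw [Equiv.Perm.mul_apply, Equiv.swap_apply_left, Equiv.swap_apply_self]
  obtain ⟨s, hsK, hs⟩ := hperm π
  refine ⟨fun t => s * ψ t * s⁻¹, fun t => K.mul_mem (K.mul_mem hsK (hψK t)) (K.inv_mem hsK),
    fun t x => ?_⟩
  have hs3 : lin 3 s (IsFrame.normal v 3) = IsFrame.normal v k := by
    rw [IsFrame.normal, map_sub, map_smul, map_sum, hs, hπ3]
    simp only [hs]
    rw [Equiv.sum_comp π v]
    rfl
  rw [lin_mul_apply, lin_mul_apply, hψ, translation_conj, hs, hπ0, hs3]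

/-- The mutual products are a direct computation. That the vectors are lightlike and future-pointing
is inherited from the frame, since each is a positive multiple of an isometric image of a frame
vector. -/
theorem IsFrame.isFrame_doubled {v : Fin (3 + 1) → Fin (3 + 1) → ℝ} (hv : IsFrame v) {g : Isom 3}
    (hg : ∃ i, ∃ c : ℝ, 0 < c ∧ doubled v 2 = c • Hyperbolic.lin 3 g (v i)) {h : Isom 3}
    (hh : ∃ i, ∃ c : ℝ, 0 < c ∧ doubled v 3 = c • Hyperbolic.lin 3 h (v i)) :
    IsFrame (doubled v) := by
  have hcross : ∀ i j, i < j → form (doubled v i) (doubled v j) = -1 := by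
    intro i j hij
    fin_cases i <;> fin_cases j <;> first | (exact absurd hij (by decide)) | skip
    all_goals
      simp [doubled, form_add_left, form_sub_left, form_smul_left, form_add_right, form_sub_right,
        form_smul_right, hv.form_eq]
    all_goals norm_num
  have hlight : ∀ {g : Isom 3} {k : Fin (3 + 1)},
      (∃ i, ∃ c : ℝ, 0 < c ∧ doubled v k = c • Hyperbolic.lin 3 g (v i)) →
      form (doubled v k) (doubled v k) = 0 ∧ 0 < doubled v k 0 := by
    rintro g k ⟨i, c, hc, h⟩
    rw [h]
    exact ⟨by rw [form_smul_left, form_smul_right, form_lin, hv.self, mul_zero, mul_zero],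
      mul_pos hc ((hv.lin g).pos i)⟩
  have h0 : ∀ k : Fin (3 + 1), form (doubled v k) (doubled v k) = 0 ∧ 0 < doubled v k 0 := by
    intro k
    fin_cases k
    · exact hlight (g := 1) ⟨0, 2, by norm_num, by rw [lin_one_apply]; rfl⟩
    · exact hlight (g := 1) ⟨1, 1 / 2, by norm_num, by rw [lin_one_apply]; rfl⟩
    · exact hlight hg
    · exact hlight hh
  refine ⟨fun i => (h0 i).1, fun i j hij => ?_, fun i => (h0 i).2⟩
  rcases lt_or_gt_of_ne hij with h | h
  · exact hcross i j h
  · rw [form_comm, hcross j i h]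

/-- The crux of dimension three: this vertex of the translated simplex is a vertex of a reflected
copy of σ, although the translated simplex is not itself such a copy. -/
theorem IsFrame.doubled_two {v : Fin (3 + 1) → Fin (3 + 1) → ℝ} (hv : IsFrame v) :
    doubled v 2 = (1 / 2 : ℝ) • Hyperbolic.lin 3 (refl (hv.normal_pos (by norm_num) 1) *
      refl (hv.normal_pos (by norm_num) 3)) (v 3) := by
  rw [lin_mul_apply, hv.lin_refl_normal_three, sum_univ_three_add_one]
  simp only [map_sub, map_add, map_smul]
  rw [hv.lin_refl_normal_three, hv.lin_refl_normal_of_ne (by norm_num) (by decide),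
    hv.lin_refl_normal_of_ne (by norm_num) (by decide),
    hv.lin_refl_normal_of_ne (by norm_num) (by decide), sum_univ_three_add_one]
  change v 0 + v 2 - (1 / 2 : ℝ) • v 1 = _
  module

theorem IsFrame.doubled_three {v : Fin (3 + 1) → Fin (3 + 1) → ℝ} (hv : IsFrame v) :
    doubled v 3 = (1 / 2 : ℝ) • Hyperbolic.lin 3 (refl (hv.normal_pos (by norm_num) 1) *
      refl (hv.normal_pos (by norm_num) 2)) (v 2) := by
  rw [lin_mul_apply, hv.lin_refl_normal_three, sum_univ_three_add_one]
  simp only [map_sub, map_add, map_smul]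
  rw [hv.lin_refl_normal_three, hv.lin_refl_normal_of_ne (by norm_num) (by decide),
    hv.lin_refl_normal_of_ne (by norm_num) (by decide),
    hv.lin_refl_normal_of_ne (by norm_num) (by decide), sum_univ_three_add_one]
  change v 0 + v 3 - (1 / 2 : ℝ) • v 1 = _
  module

theorem IsFrame.exists_doubling {v : Fin (3 + 1) → Fin (3 + 1) → ℝ} (hv : IsFrame v) :
    ∃ d : Isom 3, ∀ i, Hyperbolic.lin 3 d (v i) = doubled v i :=
  hv.exists_isom (by norm_num) (hv.isFrame_doubled ⟨3, 1 / 2, by norm_num, hv.doubled_two⟩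
    ⟨2, 1 / 2, by norm_num, hv.doubled_three⟩)

/-! ### Orientation, Haar measure and null sets of the boundary. -/

theorem det_refl {e : Fin (n + 1) → ℝ} (he : 0 < form e e) : (refl he).1.1.det = -1 := by
  have h : (refl he).1.1 = 1 + Matrix.replicateCol Unit (-(2 / form e e) • e) *
      Matrix.replicateRow Unit fun j => form (Pi.single j 1) e := by
    ext i j
    have h1 := congrFun (lin_refl he (Pi.single j 1)) i
    rw [lin_apply, Matrix.mulVec_single_one] at h1
    simp only [Matrix.col_apply] at h1
    rw [h1]
    simp [Matrix.mul_apply, Matrix.one_apply, Pi.single_apply]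
    ring
  rw [h, Matrix.det_one_add_replicateCol_mul_replicateRow, dotProduct_smul]
  have h2 : (fun j => form (Pi.single j 1) e) ⬝ᵥ e = form e e := by
    conv_rhs => rw [← Finset.univ_sum_single e, form_sum_left, Finset.univ_sum_single e]
    refine Finset.sum_congr rfl fun j _ => ?_
    rw [show (Pi.single j (e j) : Fin (n + 1) → ℝ) = e j • Pi.single j 1 by
      rw [← Pi.single_smul, smul_eq_mul, mul_one], form_smul_left, mul_comm]
  rw [h2, smul_eq_mul, neg_mul, div_mul_cancel₀ _ he.ne']
  norm_num

theorem det_ne_zero (g : Isom n) : g.1.1.det ≠ 0 :=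
  ((Matrix.isUnit_iff_isUnit_det _).1 g.1.isUnit).ne_zero

theorem det_mul (g h : Isom n) : (g * h).1.1.det = g.1.1.det * h.1.1.det := by
  rw [Subgroup.coe_mul, Units.val_mul, Matrix.det_mul]

instance (n : ℕ) : MeasurableSpace (Isom n) := borel _

instance (n : ℕ) : BorelSpace (Isom n) := ⟨rfl⟩

instance (n : ℕ) : SecondCountableTopology (Isom n) := by
  have : SecondCountableTopology (Matrix (Fin (n + 1)) (Fin (n + 1)) ℝ) :=
    inferInstanceAs (SecondCountableTopology (Fin (n + 1) → Fin (n + 1) → ℝ))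
  have : SecondCountableTopology (Matrix (Fin (n + 1)) (Fin (n + 1)) ℝ)ᵐᵒᵖ :=
    MulOpposite.opHomeomorph.symm.isInducing.secondCountableTopology
  have : SecondCountableTopology (GL (Fin (n + 1)) ℝ) :=
    Units.isEmbedding_embedProduct.isInducing.secondCountableTopology
  exact Topology.IsInducing.subtypeVal.secondCountableTopology

theorem isOpen_isomPlus (n : ℕ) : IsOpen (IsomPlus n : Set (Isom n)) :=
  isOpen_lt continuous_const ((Units.continuous_val.comp continuous_subtype_val).matrix_det)

/-- A property that holds almost everywhere for Haar measure on the group of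
orientation-preserving isometries holds at almost every orientation-preserving element for Haar
measure on the group of all isometries. -/
theorem ae_isom_of_ae_isomPlus {P : Isom n → Prop}
    (h : ∀ᵐ g : IsomPlus n ∂Measure.haar, P g) :
    ∀ᵐ g : Isom n ∂Measure.haar, g ∈ IsomPlus n → P g := by
  have hemb : Topology.IsOpenEmbedding (IsomPlus n).subtype :=
    (isOpen_isomPlus n).isOpenEmbedding_subtypeVal
  have hme := hemb.measurableEmbedding
  have hmul : MeasurableMul (Isom n) := inferInstance
  have : (Measure.comap (IsomPlus n).subtype (Measure.haar : Measure (Isom n))).IsHaarMeasure :=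
    Measure.IsHaarMeasure.comap (mH := hmul) _ hemb
  have hsc : SecondCountableTopology (IsomPlus n) :=
    Topology.IsInducing.subtypeVal.secondCountableTopology
  have hac : Measure.comap (IsomPlus n).subtype (Measure.haar : Measure (Isom n)) ≪
      (Measure.haar : Measure (IsomPlus n)) := Measure.absolutelyContinuous_isHaarMeasure _ _
  have h1 := hac.ae_le h
  have h2 : ∀ᵐ g ∂(Measure.comap (IsomPlus n).subtype (Measure.haar : Measure (Isom n))).map
      (IsomPlus n).subtype, P g := hme.ae_map_iff.2 h1
  rw [hme.map_comap, ae_restrict_iff' hme.measurableSet_range] at h2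
  filter_upwards [h2] with g hg hgm
  exact hg ⟨⟨g, hgm⟩, rfl⟩

instance (n : ℕ) : ContinuousSMul (Isom n) (Boundary n) where
  continuous_smul := by
    have hl : Continuous fun p : Isom n × Boundary n => lightVec p.2 := by
      refine continuous_pi fun i => ?_
      refine Fin.cases ?_ (fun k => ?_) i
      · exact continuous_const
      · exact ((PiLp.continuous_apply 2 _ k).comp continuous_subtype_val).comp continuous_snd
    have hc : Continuous fun p : Isom n × Boundary n => p.1.1.1 *ᵥ lightVec p.2 :=
      ((Units.continuous_val.comp continuous_subtype_val).comp continuous_fst).matrix_mulVec hl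
    refine Continuous.subtype_mk ((PiLp.continuous_toLp 2 _).comp (continuous_pi fun k => ?_)) _
    exact ((continuous_apply k.succ).comp hc).div ((continuous_apply 0).comp hc) fun p =>
      (isom_time_pos p.1 (form_lightVec p.2) (by simp [lightVec])).ne'

theorem exists_smul_eq (b c : Boundary n) : ∃ g : Isom n, g • b = c := by
  by_cases h : b = c
  · exact ⟨1, by rw [one_smul, h]⟩
  · have hpos : 0 < form (lightVec b - lightVec c) (lightVec b - lightVec c) := by
      have := form_lightVec_neg h
      simp only [form_sub_left, form_sub_right, form_lightVec, form_comm (lightVec c)]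
      linarith
    refine ⟨refl hpos, smul_eq_of_lin_eq_smul (t := 1) ?_⟩
    rw [one_smul, lin_refl_sub (by rw [form_lightVec, form_lightVec]) hpos]

open scoped Pointwise

/-- The measure `toSphere` is a multiple of the volume of the truncated cone, and the full cone is
covered by countably many dilates of it. The full cone is better suited to isometries, which rescale
light vectors. -/
theorem boundaryMeasure_eq_zero_iff (hn : 1 ≤ n) {N : Set (Boundary n)} (hN : MeasurableSet N) :
    boundaryMeasure n N = 0 ↔
      (volume : Measure (EuclideanSpace ℝ (Fin n))) (Set.Ioi (0 : ℝ) • (Subtype.val '' N)) = 0 := by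
  rw [boundaryMeasure, Measure.toSphere_apply' _ hN, finrank_euclideanSpace_fin, mul_eq_zero,
    or_iff_right (by exact_mod_cast (by omega : n ≠ 0))]
  constructor
  · intro h
    have hsub : Set.Ioi (0 : ℝ) • (Subtype.val '' N) ⊆
        ⋃ m : ℕ, (m + 1 : ℝ) • (Set.Ioo (0 : ℝ) 1 • (Subtype.val '' N)) := by
      rintro _ ⟨r, hr, x, hx, rfl⟩
      obtain ⟨m, hm⟩ := exists_nat_gt r
      have hm1 : (0 : ℝ) < m + 1 := by positivity
      refine Set.mem_iUnion.2 ⟨m, (r / (m + 1)) • x, ⟨r / (m + 1), ⟨div_pos hr hm1, ?_⟩, x, hx, rfl⟩, ?_⟩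
      · rw [div_lt_one hm1]; linarith
      · simp only [smul_smul]
        rw [mul_div_cancel₀ _ hm1.ne']
    refine measure_mono_null hsub (measure_iUnion_null fun m => ?_)
    rw [Measure.addHaar_smul, h, mul_zero]
  · exact fun h => measure_mono_null (Set.smul_subset_smul_right fun r hr => hr.1) h

/-- The linear action on the future light cone, parametrized by its spatial coordinates. -/
def coneMap (g : Isom n) (x : EuclideanSpace ℝ (Fin n)) : EuclideanSpace ℝ (Fin n) :=
  WithLp.toLp 2 fun i => lin n g (Fin.cons ‖x‖ x.ofLp) i.succ

theorem differentiableOn_coneMap (g : Isom n) : DifferentiableOn ℝ (coneMap g) {0}ᶜ := by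
  intro x hx
  refine DifferentiableAt.differentiableWithinAt ?_
  rw [differentiableAt_euclidean]
  intro i
  have h1 : DifferentiableAt ℝ (fun x : EuclideanSpace ℝ (Fin n) =>
      (Fin.cons ‖x‖ x.ofLp : Fin (n + 1) → ℝ)) x := by
    rw [differentiableAt_pi]
    intro j
    refine Fin.cases ?_ (fun k => ?_) j
    · simp only [Fin.cons_zero]
      exact (contDiffAt_norm ℝ hx).differentiableAt one_ne_zero
    · simp only [Fin.cons_succ]
      fun_prop
  have h2 := (LinearMap.toContinuousLinearMap (lin n g)).differentiableAt.comp x h1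
  exact (differentiableAt_pi.1 h2) i.succ

/-- Isometries preserve the null sets of the boundary. -/
theorem boundaryMeasure_preimage_smul (hn : 1 ≤ n) (g : Isom n) {N : Set (Boundary n)}
    (hN : MeasurableSet N) (h : boundaryMeasure n N = 0) :
    boundaryMeasure n {b | g • b ∈ N} = 0 := by
  have hM : MeasurableSet {b : Boundary n | g • b ∈ N} :=
    (continuous_const_smul g).measurable hN
  rw [boundaryMeasure_eq_zero_iff hn hN] at h
  rw [boundaryMeasure_eq_zero_iff hn hM]
  have hsub : Set.Ioi (0 : ℝ) • (Subtype.val '' N) ⊆ ({0}ᶜ : Set (EuclideanSpace ℝ (Fin n))) := by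
    rintro _ ⟨r, hr, _, ⟨b, _, rfl⟩, rfl⟩
    have hb : (b : EuclideanSpace ℝ (Fin n)) ≠ 0 := ne_zero_of_mem_unit_sphere b
    exact smul_ne_zero (ne_of_gt hr) hb
  -- The cone over the preimage lies in the image of the cone over N under `coneMap g⁻¹`, and
  -- differentiable maps send null sets to null sets.
  refine measure_mono_null ?_ (addHaar_image_eq_zero_of_differentiableOn_of_addHaar_eq_zero
    volume ((differentiableOn_coneMap g⁻¹).mono hsub) h)
  rintro _ ⟨r, hr, _, ⟨b, hb, rfl⟩, rfl⟩
  obtain ⟨c, hc, hcb⟩ := exists_lin_lightVec g⁻¹ (g • b)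
  rw [inv_smul_smul] at hcb
  have hr0 : 0 < r := hr
  refine ⟨(r / c) • (g • b : Boundary n).1, ⟨r / c, div_pos hr0 hc, _, ⟨_, hb, rfl⟩, rfl⟩, ?_⟩
  have hnorm : ‖(r / c) • (g • b : Boundary n).1‖ = r / c := by
    rw [norm_smul, norm_eq_of_mem_sphere, mul_one, Real.norm_of_nonneg (div_pos hr0 hc).le]
  have hcons : (Fin.cons ‖(r / c) • (g • b : Boundary n).1‖
      ((r / c) • (g • b : Boundary n).1).ofLp : Fin (n + 1) → ℝ) = (r / c) • lightVec (g • b) := by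
    rw [hnorm]
    ext i
    refine Fin.cases ?_ (fun k => ?_) i
    · simp [lightVec]
    · simp [lightVec]
  ext i
  simp only [coneMap, hcons, map_smul, hcb, smul_smul]
  rw [div_mul_cancel₀ _ hc.ne']
  simp [lightVec]

/-- Null sets of the boundary can be tested on the orbit of a point. -/
theorem boundaryMeasure_eq_zero_of_ae_notMem (hn : 1 ≤ n) {N : Set (Boundary n)}
    (hN : MeasurableSet N) (b₀ : Boundary n)
    (h : ∀ᵐ g : Isom n ∂Measure.haar, g • b₀ ∉ N) : boundaryMeasure n N = 0 := by
  have : IsFiniteMeasure (boundaryMeasure n) := by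
    unfold boundaryMeasure; infer_instance
  have hall : ∀ b : Boundary n, ∀ᵐ g : Isom n ∂Measure.haar, g • b ∉ N := fun b => by
    obtain ⟨k, rfl⟩ := exists_smul_eq b₀ b
    have := (quasiMeasurePreserving_mul_right Measure.haar k).ae h
    simpa only [mul_smul] using this
  have hms : MeasurableSet {p : Isom n × Boundary n | p.1 • p.2 ∉ N} :=
    (continuous_smul.measurable hN).compl
  -- By Fubini a single g pulls N back to a null set; g⁻¹ then carries this back to N.
  obtain ⟨g, hg⟩ := ((Measure.ae_ae_comm (ν := boundaryMeasure n) hms).2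
    (Filter.Eventually.of_forall hall)).exists
  have hg0 : boundaryMeasure n {b | g • b ∈ N} = 0 := by
    simpa [ae_iff] using hg
  have := boundaryMeasure_preimage_smul hn g⁻¹ ((continuous_const_smul g).measurable hN) hg0
  convert this using 2
  ext b
  simp

/-! ### The commutant and its density. -/

/-- The isometries that commute almost everywhere with `f` as right translations. -/
def commutant (f : Isom n → Isom n) : Subgroup (Isom n) where
  carrier := {h | ∀ᵐ g ∂Measure.haar, f (g * h) = f g * h}
  one_mem' := by simp
  mul_mem' := by
    intro a b ha hb
    have ha' : ∀ᵐ g ∂Measure.haar, f (g * a) = f g * a := ha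
    have hb' : ∀ᵐ g ∂Measure.haar, f (g * b) = f g * b := hb
    have := (quasiMeasurePreserving_mul_right Measure.haar a).ae hb'
    rw [Set.mem_ofPred_eq]
    filter_upwards [ha', this] with g h1 h2
    rw [← mul_assoc, h2, h1, mul_assoc]
  inv_mem' := by
    intro a ha
    have ha' : ∀ᵐ g ∂Measure.haar, f (g * a) = f g * a := ha
    have := (quasiMeasurePreserving_mul_right Measure.haar a⁻¹).ae ha'
    rw [Set.mem_ofPred_eq]
    filter_upwards [this] with g h1
    rw [inv_mul_cancel_right] at h1
    rw [h1, mul_inv_cancel_right]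

theorem mem_commutant {f : Isom n → Isom n} {h : Isom n} :
    h ∈ commutant f ↔ ∀ᵐ g ∂Measure.haar, f (g * h) = f g * h := Iff.rfl

section

variable {φ : Boundary n → Boundary n} {σ : Fin (n + 1) → Boundary n} {f : Isom n → Isom n}

/-- An isometry is determined by its values on the vertices of σ, so f(gh) and f(g)h can be compared
vertex by vertex, with a different k for each. The simplex hσ need not be the image of σ under a
known element of the commutant. -/
theorem mem_commutant_of_smul_eq (hn : 3 ≤ n) (hσ : σ ∈ RegularIdeal n)
    (hf : ∀ᵐ g ∂Measure.haar, ∀ i, φ (g • σ i) = f g • σ i) {h : Isom n}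
    (hh : ∀ i, ∃ k ∈ commutant f, ∃ j, h • σ i = k • σ j) : h ∈ commutant f := by
  have key : ∀ i, ∀ᵐ g ∂Measure.haar, φ ((g * h) • σ i) = (f g * h) • σ i := fun i => by
    obtain ⟨k, hk, j, hkj⟩ := hh i
    filter_upwards [mem_commutant.1 hk,
      (quasiMeasurePreserving_mul_right Measure.haar k).ae hf] with g h1 h2
    rw [mul_smul, hkj, ← mul_smul, h2, h1, mul_smul, mul_smul, hkj]
  rw [mem_commutant]
  filter_upwards [ae_all_iff.2 key, (quasiMeasurePreserving_mul_right Measure.haar h).ae hf]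
    with g h1 h2
  exact RegularIdeal.isom_ext hn hσ fun i => (h2 i).symm.trans (h1 i)

theorem perm_mem_commutant (hn : 3 ≤ n) (hσ : σ ∈ RegularIdeal n)
    (hf : ∀ᵐ g ∂Measure.haar, ∀ i, φ (g • σ i) = f g • σ i) {s : Isom n}
    {π : Equiv.Perm (Fin (n + 1))} (hs : ∀ i, s • σ i = σ (π i)) : s ∈ commutant f :=
  mem_commutant_of_smul_eq hn hσ hf fun i => ⟨1, one_mem _, π i, by rw [hs, one_smul]⟩

/-- The isometry f(g)⁻¹f(gρ) fixes all vertices but one, so it is 1 or ρ; as ρ reverses orientation,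
`hdet` rules out 1. -/
theorem refl_mem_commutant (hn : 3 ≤ n) (hσ : σ ∈ RegularIdeal n)
    (hf : ∀ᵐ g ∂Measure.haar, ∀ i, φ (g • σ i) = f g • σ i)
    (hdet : ∀ᵐ g ∂Measure.haar, 0 < (f g).1.1.det * g.1.1.det) (i : Fin (n + 1)) :
    refl ((RegularIdeal.isFrame hn hσ).normal_pos (by omega) i) ∈ commutant f := by
  have hv := RegularIdeal.isFrame hn hσ
  set ρ := refl (hv.normal_pos (by omega) i) with hρ
  have hρk : ∀ k, k ≠ i → ρ • σ k = σ k := fun k hk =>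
    smul_eq_of_lin_toFrame hn hσ (t := 1)
      (by rw [one_smul, hv.lin_refl_normal_of_ne (by omega) hk])
  have h1 := (quasiMeasurePreserving_mul_right Measure.haar ρ).ae hf
  have h2 := (quasiMeasurePreserving_mul_right Measure.haar ρ).ae hdet
  rw [mem_commutant]
  filter_upwards [hf, hdet, h1, h2] with g hg hgd hg' hgd'
  set h := (f g)⁻¹ * f (g * ρ) with hh
  have hfh : f (g * ρ) = f g * h := by rw [hh, mul_inv_cancel_left]
  have hk : ∀ k, k ≠ i → h • σ k = σ k := fun k hk => by
    rw [hh, mul_smul, ← hg', mul_smul, hρk k hk, hg, inv_smul_smul]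
  have hext : ∀ {a : Isom n}, (∀ k, k ≠ i → a • σ k = σ k) → h • σ i = a • σ i → h = a :=
    fun ha hi => RegularIdeal.isom_ext hn hσ fun k => by
      by_cases hki : k = i
      · rw [hki, hi]
      · rw [hk k hki, ha k hki]
  rw [hfh]
  rcases RegularIdeal.eq_or_eq_refl hn hσ (RegularIdeal.smul hσ h) i hk with h3 | h3
  · exfalso
    have : h = 1 := hext (fun k _ => one_smul _ _) (by rw [one_smul]; exact h3)
    rw [hfh, this, mul_one, det_mul, det_refl] at hgd'
    linarith
  · rw [hext hρk h3]

theorem doubling_mem_commutant {φ : Boundary 3 → Boundary 3} {σ : Fin (3 + 1) → Boundary 3}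
    {f : Isom 3 → Isom 3} (hσ : σ ∈ RegularIdeal 3)
    (hf : ∀ᵐ g ∂Measure.haar, ∀ i, φ (g • σ i) = f g • σ i)
    (hdet : ∀ᵐ g ∂Measure.haar, 0 < (f g).1.1.det * g.1.1.det) {d : Isom 3}
    (hd : ∀ i, lin 3 d (toFrame σ i) = doubled (toFrame σ) i) : d ∈ commutant f := by
  have hv := RegularIdeal.isFrame le_rfl hσ
  have hρ := refl_mem_commutant le_rfl hσ hf hdet
  have key : ∀ (k : Isom 3) (i j : Fin (3 + 1)) (c : ℝ),
      doubled (toFrame σ) i = c • lin 3 k (toFrame σ j) → d • σ i = k • σ j := by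
    intro k i j c h
    have h1 : (k⁻¹ * d) • σ i = σ j := by
      refine smul_eq_of_lin_toFrame le_rfl hσ (t := c) ?_
      rw [lin_mul_apply, hd, h, map_smul, lin_inv_apply_self]
    rw [← h1, mul_smul, smul_inv_smul]
  refine mem_commutant_of_smul_eq le_rfl hσ hf fun i => ?_
  fin_cases i
  · exact ⟨1, one_mem _, 0, key 1 0 0 2 (by rw [lin_one_apply]; rfl)⟩
  · exact ⟨1, one_mem _, 1, key 1 1 1 (1 / 2) (by rw [lin_one_apply]; rfl)⟩
  · exact ⟨_, mul_mem (hρ 1) (hρ 3), 3, key _ 2 3 (1 / 2) hv.doubled_two⟩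
  · exact ⟨_, mul_mem (hρ 1) (hρ 2), 2, key _ 3 2 (1 / 2) hv.doubled_three⟩

/-- For n > 3 the reflections alone suffice; n = 3 also uses the symmetries of σ and the doubling.
-/
theorem dense_commutant (hn : 3 ≤ n) (hσ : σ ∈ RegularIdeal n)
    (hf : ∀ᵐ g ∂Measure.haar, ∀ i, φ (g • σ i) = f g • σ i)
    (hdet : ∀ᵐ g ∂Measure.haar, 0 < (f g).1.1.det * g.1.1.det) :
    Dense (commutant f : Set (Isom n)) := by
  have hle := (commutant f).le_topologicalClosure
  have hcl := (commutant f).isClosed_topologicalClosure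
  have hrefl := fun i => hle (refl_mem_commutant hn hσ hf hdet i)
  have htop : (commutant f).topologicalClosure = ⊤ := by
    rcases hn.lt_or_eq with h3 | rfl
    · exact eq_top_of_refl_normal_mem h3 (RegularIdeal.isFrame hn hσ) hcl hrefl
    · have hv := RegularIdeal.isFrame le_rfl hσ
      refine eq_top_of_doubled_mem hv hcl hrefl (fun π => ?_) ?_
      · obtain ⟨s, hs⟩ := hσ.2 π
        refine ⟨s, hle (perm_mem_commutant le_rfl hσ hf hs), fun i => ?_⟩
        obtain ⟨t, ht⟩ := hv.exists_isom (by norm_num) (hv.comp_perm π)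
        have : s = t := RegularIdeal.isom_ext le_rfl hσ fun i => by
          rw [hs]
          exact (smul_eq_of_lin_toFrame le_rfl hσ (t := 1) (by rw [ht, one_smul]; rfl)).symm
        rw [this, ht]
        rfl
      · obtain ⟨d, hd⟩ := hv.exists_doubling
        exact ⟨d, hle (doubling_mem_commutant hσ hf hdet hd), hd⟩
  rw [dense_iff_closure_eq, ← Subgroup.topologicalClosure_coe, htop, Subgroup.coe_top]

/-! ### From a dense commutant to the isometry g₀. -/

theorem measurable_lightVec : Measurable (lightVec (n := n)) := by
  refine Continuous.measurable (continuous_pi fun i => ?_)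
  refine Fin.cases ?_ (fun k => ?_) i
  · exact continuous_const
  · exact (PiLp.continuous_apply 2 _ k).comp continuous_subtype_val

theorem measurable_form_comp {X : Type*} [MeasurableSpace X] {u w : X → Fin (n + 1) → ℝ}
    (hu : Measurable u) (hw : Measurable w) : Measurable fun x => form (u x) (w x) :=
  continuous_form.measurable.comp (hu.prodMk hw)

theorem measurable_toFrame (i : Fin (n + 1)) :
    Measurable fun τ : Fin (n + 1) → Boundary n => toFrame τ i := by
  have h : ∀ j, Measurable fun τ : Fin (n + 1) → Boundary n => lightVec (τ j) := fun j =>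
    measurable_lightVec.comp (measurable_pi_apply j)
  refine Measurable.smul (Measurable.sqrt (Measurable.div ?_ (Measurable.mul ?_ ?_))) (h i)
  · exact (measurable_form_comp (h _) (h _)).neg
  · exact measurable_form_comp (h _) (h _)
  · exact measurable_form_comp (h _) (h _)

/-- If `φ` is given on the vertices of almost every regular simplex `g σ` by an isometry `f g` of
the same orientation as `g`, then `f` is almost everywhere a left translation. -/
theorem exists_ae_eq_mul (hn : 3 ≤ n) (hφ : Measurable φ) (hσ : σ ∈ RegularIdeal n)
    (hf : ∀ᵐ g ∂Measure.haar, ∀ i, φ (g • σ i) = f g • σ i)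
    (hdet : ∀ᵐ g ∂Measure.haar, 0 < (f g).1.1.det * g.1.1.det) :
    ∃ g₀ ∈ IsomPlus n, ∀ᵐ g ∂Measure.haar, f g = g₀ * g := by
  have hv := RegularIdeal.isFrame hn hσ
  have hn1 : 1 ≤ n := by omega
  let V : Matrix (Fin (n + 1)) (Fin (n + 1)) ℝ := Matrix.of fun i j => toFrame σ j i
  have hVdet : IsUnit V.det := by
    have h1 : LinearIndependent ℝ Vᵀ.row := hv.linearIndependent hn1
    rw [← Matrix.det_transpose]
    exact (Matrix.isUnit_iff_isUnit_det _).1 (Matrix.linearIndependent_rows_iff_isUnit.1 h1)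
  -- The map f is not assumed measurable. The frame of the image simplex is a measurable function of
  -- g and equals f(g) applied to the frame of σ.
  let W : Isom n → Matrix (Fin (n + 1)) (Fin (n + 1)) ℝ := fun g =>
    Matrix.of fun i j => toFrame (fun k => φ (g • σ k)) j i
  have hfW : ∀ᵐ g ∂Measure.haar, (f g).1.1 = W g * V⁻¹ := by
    filter_upwards [hf] with g hg
    have h1 : (f g).1.1 * V = W g := by
      ext i j
      have hreg := RegularIdeal.smul hσ (f g)
      have h2 := congrFun (lin_toFrame hn hσ hreg (f g) (fun _ => rfl) j) i
      simp only [W, Matrix.of_apply, hg]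
      rw [← h2]
      rfl
    rw [← h1, Matrix.mul_assoc, Matrix.mul_nonsing_inv _ hVdet, Matrix.mul_one]
  have hWm : ∀ i j, Measurable fun g => W g i j := fun i j => by
    have h1 : Measurable fun g : Isom n => fun k => φ (g • σ k) :=
      measurable_pi_lambda _ fun k => hφ.comp
        (continuous_id.smul continuous_const).measurable
    exact (measurable_pi_apply i).comp ((measurable_toFrame j).comp h1)
  have hinvm : ∀ i j, Measurable fun g : Isom n => (g⁻¹).1.1 i j := fun i j =>
    ((Units.continuous_val.comp (continuous_subtype_val.comp continuous_inv)).matrix_elem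
      i j).measurable
  -- A measurable version of f(g)g⁻¹. For h in the commutant it is unchanged under g ↦ gh, since
  -- f(g)h(gh)⁻¹ = f(g)g⁻¹.
  let F : Isom n → Matrix (Fin (n + 1)) (Fin (n + 1)) ℝ := fun g => W g * V⁻¹ * (g⁻¹).1.1
  have hFf : ∀ᵐ g ∂Measure.haar, F g = (f g * g⁻¹).1.1 := by
    filter_upwards [hfW] with g hg
    rw [Subgroup.coe_mul, Units.val_mul, hg]
  have hFm : ∀ i j, Measurable fun g => F g i j := fun i j => by
    simp only [F, Matrix.mul_apply]
    exact Finset.measurable_fun_sum _ fun k _ =>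
      (Finset.measurable_fun_sum _ fun l _ => (hWm i l).mul measurable_const).mul (hinvm k j)
  have hconst : ∀ i j, ∃ c, ∀ᵐ g ∂(Measure.haar : Measure (Isom n)), F g i j = c := fun i j => by
    refine exists_ae_eq_const_of_dense_mul_right (hFm i j)
      ((dense_commutant hn hσ hf hdet).mono fun h hh => ?_)
    have hF' := (quasiMeasurePreserving_mul_right Measure.haar h).ae hFf
    rw [Set.mem_ofPred_eq]
    filter_upwards [mem_commutant.1 hh, hFf, hF'] with g h1 h2 h3
    rw [h3, h2, h1, mul_inv_rev, mul_assoc, mul_inv_cancel_left]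
  choose C hC using hconst
  have hall : ∀ᵐ g ∂Measure.haar, ∀ i j, F g i j = C i j :=
    ae_all_iff.2 fun i => ae_all_iff.2 fun j => hC i j
  have hgood : ∀ᵐ g ∂Measure.haar, (f g * g⁻¹).1.1 = Matrix.of C ∧
      0 < (f g).1.1.det * g.1.1.det := by
    filter_upwards [hall, hFf, hdet] with g h1 h2 h3
    refine ⟨?_, h3⟩
    rw [← h2]
    ext i j
    exact h1 i j
  -- A good point shows that the constant matrix belongs to the group. It can be chosen
  -- orientation-preserving because `IsomPlus n` is open and thus has positive measure.
  obtain ⟨g₁, hg₁, hg₁C, hg₁d⟩ : ∃ g₁ ∈ IsomPlus n, (f g₁ * g₁⁻¹).1.1 = Matrix.of C ∧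
      0 < (f g₁).1.1.det * g₁.1.1.det := by
    by_contra! hcon
    have h0 : (Measure.haar : Measure (Isom n)) (IsomPlus n : Set (Isom n)) = 0 := by
      refine measure_mono_null (fun g hg => ?_) (ae_iff.1 hgood)
      rintro ⟨h1, h2⟩
      exact absurd h2 (not_lt.2 (hcon g hg h1))
    exact (isOpen_isomPlus n).measure_ne_zero _ ⟨1, one_mem _⟩ h0
  refine ⟨f g₁ * g₁⁻¹, ?_, ?_⟩
  · have hpos : 0 < g₁.1.1.det := hg₁
    have hpos' : 0 < (f g₁).1.1.det := pos_of_mul_pos_left hg₁d hpos.le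
    exact (IsomPlus n).mul_mem hpos' ((IsomPlus n).inv_mem hg₁)
  · filter_upwards [hgood] with g hg
    have : f g * g⁻¹ = f g₁ * g₁⁻¹ := Subtype.ext (Units.ext (hg.1.trans hg₁C.symm))
    rw [← this, inv_mul_cancel_right]

/-- A map that sends the vertices of almost every positively oriented regular ideal simplex to the
vertices of such a simplex sends the vertices of almost every regular ideal simplex to those of a
regular ideal simplex with the same orientation. -/
theorem ae_mem_regularIdeal (hn : 3 ≤ n) (hσ : σ ∈ RegularIdealPos n)
    (h : ∀ᵐ τ ∂(regularMeasure σ), (fun i => φ (τ i)) ∈ RegularIdealPos n) :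
    ∀ᵐ g : Isom n ∂Measure.haar, (fun i => φ (g • σ i)) ∈ RegularIdeal n ∧
      0 < orientation (fun i => φ (g • σ i)) * g.1.1.det := by
  have h1 : ∀ᵐ g : IsomPlus n ∂Measure.haar, (fun i => φ (g.1 • σ i)) ∈ RegularIdealPos n :=
    ae_of_ae_map (measurable_orbit σ).aemeasurable h
  have h2 := ae_isom_of_ae_isomPlus (P := fun g => (fun i => φ (g • σ i)) ∈ RegularIdealPos n) h1
  -- The isometry s reverses orientation, as it transposes two vertices. If g reverses orientation,
  -- then gs preserves it, and gsσ has the same vertices as gσ.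
  obtain ⟨s, hs⟩ := hσ.1.2 (Equiv.swap 0 1)
  have h01 : (0 : Fin (n + 1)) ≠ 1 := by
    obtain ⟨h, -⟩ := fin_add_one_ne hn 0
    rwa [zero_add] at h
  have hsdet : s.1.1.det < 0 := by
    obtain ⟨c, hc, hco⟩ := orientation_smul s σ
    simp only [hs] at hco
    rw [orientation_perm, Equiv.Perm.sign_swap h01] at hco
    have hpos := hσ.2
    by_contra hcon
    have := mul_nonneg hc.le (mul_nonneg (not_lt.1 hcon) hpos.le)
    rw [← hco] at this
    simp at this
    linarith
  have h3 := (quasiMeasurePreserving_mul_right Measure.haar s).ae h2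
  filter_upwards [h2, h3] with g hg hgs
  rcases lt_or_gt_of_ne (det_ne_zero g) with hneg | hpos
  · have hmem : g * s ∈ IsomPlus n := by
      change 0 < (g * s).1.1.det
      rw [det_mul]
      exact mul_pos_of_neg_of_neg hneg hsdet
    have h4 := hgs hmem
    simp only [mul_smul, hs] at h4
    refine ⟨?_, mul_pos_of_neg_of_neg ?_ hneg⟩
    · simpa using RegularIdeal.perm h4.1 (Equiv.swap 0 1)
    · have h5 := h4.2
      rw [orientation_perm (fun i => φ (g • σ i)), Equiv.Perm.sign_swap h01] at h5
      simp at h5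
      exact h5
  · have h4 := hg hpos
    exact ⟨h4.1, mul_pos h4.2 hpos⟩

theorem exists_ae_eq_smul (hn : 3 ≤ n) (hφ : Measurable φ) (hσ : σ ∈ RegularIdealPos n)
    (h : ∀ᵐ τ ∂(regularMeasure σ), (fun i => φ (τ i)) ∈ RegularIdealPos n) :
    ∃ g₀ : IsomPlus n, ∀ᵐ b ∂(boundaryMeasure n), φ b = g₀ • b := by
  classical
  have hgood := ae_mem_regularIdeal hn hσ h
  -- The default value 1 is taken only on a null set.
  let f : Isom n → Isom n := fun g =>
    if hg : (fun i => φ (g • σ i)) ∈ RegularIdeal n then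
      (RegularIdeal.exists_isom hn hσ.1 hg).choose else 1
  have hfspec : ∀ g, (fun i => φ (g • σ i)) ∈ RegularIdeal n →
      ∀ i, φ (g • σ i) = f g • σ i := fun g hg i => by
    simp only [f, dif_pos hg]
    exact ((RegularIdeal.exists_isom hn hσ.1 hg).choose_spec i).symm
  have hf : ∀ᵐ g ∂Measure.haar, ∀ i, φ (g • σ i) = f g • σ i := by
    filter_upwards [hgood] with g hg using hfspec g hg.1
  have hdet : ∀ᵐ g ∂Measure.haar, 0 < (f g).1.1.det * g.1.1.det := by
    filter_upwards [hgood] with g hg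
    obtain ⟨c, hc, hco⟩ := orientation_smul (f g) σ
    have h1 := hg.2
    simp only [hfspec g hg.1] at h1
    rw [hco] at h1
    have h2 : 0 < (c * orientation σ) * ((f g).1.1.det * g.1.1.det) := by
      rw [show (c * orientation σ) * ((f g).1.1.det * g.1.1.det) =
        c * ((f g).1.1.det * orientation σ) * g.1.1.det by ring]
      exact h1
    exact pos_of_mul_pos_right h2 (mul_pos hc hσ.2).le
  obtain ⟨g₀, hg₀, hae⟩ := exists_ae_eq_mul hn hφ hσ.1 hf hdet
  refine ⟨⟨g₀, hg₀⟩, ?_⟩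
  have hN : MeasurableSet {b | φ b ≠ g₀ • b} :=
    (measurableSet_eq_fun hφ (continuous_const_smul g₀).measurable).compl
  have := boundaryMeasure_eq_zero_of_ae_notMem (by omega) hN (σ 0) (by
    filter_upwards [hf, hae] with g h1 h2
    simp [h1, h2, mul_smul])
  rw [ae_iff]
  exact this

/-- Continuous maps that agree almost everywhere agree everywhere, since the measure of the sphere
charges open sets; the vertices of σ then determine the isometry. -/
theorem eq_of_ae_smul_eq (hn : 3 ≤ n) (hσ : σ ∈ RegularIdeal n) {g h : Isom n}
    (H : ∀ᵐ b ∂(boundaryMeasure n), g • b = h • b) : g = h := by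
  have : (boundaryMeasure n).IsOpenPosMeasure := by
    unfold boundaryMeasure; infer_instance
  have heq : (fun b : Boundary n => g • b) = fun b => h • b :=
    (continuous_const_smul g).ae_eq_iff_eq (boundaryMeasure n) (continuous_const_smul h) |>.1 H
  exact RegularIdeal.isom_ext hn hσ fun i => congrFun heq (σ i)

end

end Hyperbolic

end

theorem mainTheorem10 (n : ℕ) (hn : 3 ≤ n) :
    (∀ φ : Hyperbolic.Boundary n → Hyperbolic.Boundary n, Measurable φ →
      ∀ σ ∈ Hyperbolic.RegularIdealPos n,
        (∀ᵐ τ ∂(Hyperbolic.regularMeasure σ),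
          (fun i => φ (τ i)) ∈ Hyperbolic.RegularIdealPos n) →
        ∃! g₀ : Hyperbolic.IsomPlus n,
          ∀ᵐ b ∂(Hyperbolic.boundaryMeasure n), φ b = g₀ • b) ∧
    (3 < n → ∀ σ ∈ Hyperbolic.RegularIdeal n,
      Dense (Hyperbolic.reflectionGroup σ : Set (Hyperbolic.Isom n))) := by
  refine ⟨fun φ hφ σ hσ h => ?_, fun hn σ hσ => Hyperbolic.dense_reflectionGroup hn hσ⟩
  obtain ⟨g₀, hg₀⟩ := Hyperbolic.exists_ae_eq_smul hn hφ hσ h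
  refine ⟨g₀, hg₀, fun g hg => Subtype.ext (Hyperbolic.eq_of_ae_smul_eq hn hσ.1 ?_)⟩
  filter_upwards [hg, hg₀] with b h1 h2
  exact h1.symm.trans h2
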